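/- **Definitions.** A lattice-ordered abelian group $G$ is *archimedean* if $0\le a$ and $na\le b$ for all $n\in\mathbb N$ imply $a=0$. An *f-ring* is an associative lattice-ordered ring in which $a\wedge b=0$ and $c\ge 0$ imply $ca\wedge b=ac\wedge b=0$. An *f-algebra* is a real vector lattice with an $\mathbb R$-bilinear multiplication that makes it an f-ring; it is *unital* if it has a two-sided multiplicative unit. For an archimedean lattice-ordered abelian group $G$, let $G^d$ be its divisible hull, ordered by: $x\le y$ if and only if $n(y-x)$ belongs to the positive cone of $G$ for some integer $n\ge1$. Let $\overline{G^d}$ be the Dedekind–MacNeille completion of $G^d$ (without adjoined largest and smallest elements), which is a real vector lattice. The *vector lattice cover* $R[G]$ is the smallest vector sublattice of $\overline{G^d}$ that contains $G$. **Statement.** Let $G$ be an archimedean f-ring with unit $e_G$. Then $R[G]$ is a unital f-algebra with the same unit. That is, there is a multiplication on the vector lattice $R[G]$ that extends the multiplication of $G$ and makes $R[G]$ an f-algebra; and for every such multiplication, $e_G x = x e_G = x$ for all $x\in R[G]$. -/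

import Mathlib

/-! ### Lattice-ordered groups and f-rings -/

/-- A lattice-ordered abelian group is archimedean if `0 ≤ a` and `n a ≤ b` for all `n`
force `a = 0`. -/
class IsArchimedeanLGroup (G : Type*) [AddCommGroup G] [Lattice G] : Prop where
  eq_zero_of_forall_nsmul_le : ∀ a b : G, 0 ≤ a → (∀ n : ℕ, n • a ≤ b) → a = 0

/-- An f-ring: an (associative) lattice-ordered ring in which `a ⊓ b = 0` and `0 ≤ c` imply
`c a ⊓ b = 0` and `a c ⊓ b = 0`. -/
class IsFRing (R : Type*) [NonUnitalRing R] [Lattice R] [IsOrderedAddMonoid R] : Prop where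
  mul_nonneg : ∀ a b : R, 0 ≤ a → 0 ≤ b → 0 ≤ a * b
  mul_left_inf_eq_zero : ∀ a b c : R, a ⊓ b = 0 → 0 ≤ c → (c * a) ⊓ b = 0
  mul_right_inf_eq_zero : ∀ a b c : R, a ⊓ b = 0 → 0 ≤ c → (a * c) ⊓ b = 0

/-- A multiplication (a real bilinear map) which turns a real vector lattice `V` into
an f-algebra. -/
structure IsFAlgebraMul {V : Type*} [AddCommGroup V] [Lattice V] [IsOrderedAddMonoid V]
    [Module ℝ V] [IsOrderedModule ℝ V] (m : V →ₗ[ℝ] V →ₗ[ℝ] V) : Prop where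
  mul_assoc : ∀ a b c : V, m (m a b) c = m a (m b c)
  mul_nonneg : ∀ a b : V, 0 ≤ a → 0 ≤ b → 0 ≤ m a b
  mul_left_inf_eq_zero : ∀ a b c : V, a ⊓ b = 0 → 0 ≤ c → m c a ⊓ b = 0
  mul_right_inf_eq_zero : ∀ a b c : V, a ⊓ b = 0 → 0 ≤ c → m a c ⊓ b = 0

section LGroup

variable {G : Type*} [AddCommGroup G] [Lattice G] [IsOrderedAddMonoid G]

theorem lgroup_succ_nsmul_inf (a : G) (k : ℕ) :
    (k + 1) • (a ⊓ 0) = (k + 1) • a ⊓ k • (a ⊓ 0) := by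
  induction k with
  | zero => simp
  | succ k ih =>
    set c := a ⊓ 0 with hc
    have h1 : (k + 1 + 1) • c = ((k + 1) • c + a) ⊓ (k + 1) • c := by
      rw [succ_nsmul c (k + 1)]
      conv_lhs => rw [hc]
      rw [add_inf, add_zero]
    have h2 : (k + 1) • c + a = (k + 1 + 1) • a ⊓ (k • c + a) := by
      rw [ih, inf_add, succ_nsmul a (k + 1)]
    have h3 : (k + 1) • c ≤ k • c + a := by
      rw [succ_nsmul]
      exact add_le_add_right inf_le_left _
    rw [h1, h2, inf_assoc, inf_eq_right.2 h3]

theorem lgroup_nonneg_of_nsmul_nonneg {a : G} {n : ℕ} (hn : 0 < n) (h : 0 ≤ n • a) : 0 ≤ a := by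
  obtain ⟨k, rfl⟩ : ∃ k, n = k + 1 := ⟨n - 1, by omega⟩
  have h1 := lgroup_succ_nsmul_inf a k
  have h2 : k • (a ⊓ 0) ≤ 0 := nsmul_nonpos inf_le_right k
  rw [inf_eq_right.2 (h2.trans h), succ_nsmul] at h1
  have h3 : a ⊓ 0 = 0 := by simpa using h1
  exact inf_eq_right.1 h3

theorem lgroup_le_of_nsmul_le {a b : G} {n : ℕ} (hn : 0 < n) (h : n • a ≤ n • b) : a ≤ b := by
  have : 0 ≤ n • (b - a) := by rw [nsmul_sub]; exact sub_nonneg.2 h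
  exact sub_nonneg.1 (lgroup_nonneg_of_nsmul_nonneg hn this)

theorem lgroup_torsionFree : IsAddTorsionFree G where
  nsmul_right_injective _ hn _ _ h :=
    le_antisymm (lgroup_le_of_nsmul_le (Nat.pos_of_ne_zero hn) h.le)
      (lgroup_le_of_nsmul_le (Nat.pos_of_ne_zero hn) h.ge)

theorem lgroup_nsmul_sup_le {a b h : G} {n : ℕ} (hn : 0 < n) (ha : n • a ≤ h) (hb : n • b ≤ h) :
    n • (a ⊔ b) ≤ h := by
  have key : ∀ j k : ℕ, j + k ≤ n → n • (j • a + k • b) ≤ (j + k) • h := by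
    intro j k _
    rw [nsmul_add, add_nsmul, smul_comm n j, smul_comm n k]
    exact add_le_add (nsmul_le_nsmul_right ha j) (nsmul_le_nsmul_right hb k)
  have gen : ∀ i : ℕ, ∀ j k : ℕ, i + j + k = n → i • (a ⊔ b) + (j • a + k • b) ≤ h := by
    intro i
    induction i with
    | zero =>
      intro j k hjk
      have := key j k (by omega)
      rw [show j + k = n by omega] at this
      simpa using lgroup_le_of_nsmul_le hn this
    | succ i ih =>
      intro j k hjk
      have e1 : (i + 1) • (a ⊔ b) + (j • a + k • b)
          = (i • (a ⊔ b) + (j • a + k • b)) + (a ⊔ b) := by rw [succ_nsmul]; abel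
      rw [e1, add_sup]
      refine sup_le ?_ ?_
      · have := ih (j + 1) k (by omega)
        rw [succ_nsmul] at this
        convert this using 1; abel
      · have := ih j (k + 1) (by omega)
        rw [succ_nsmul] at this
        convert this using 1; abel
  simpa using gen n 0 0 (by omega)

theorem lgroup_nonpos_of_forall_nsmul_le [IsArchimedeanLGroup G] {a b : G}
    (h : ∀ n : ℕ, n • a ≤ b) : a ≤ 0 := by
  have gen : ∀ k j : ℕ, k • (a ⊔ 0) + j • a ≤ b := by
    intro k
    induction k with
    | zero => intro j; simpa using h j
    | succ k ih =>
      intro j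
      have e1 : (k + 1) • (a ⊔ 0) + j • a = (k • (a ⊔ 0) + j • a) + (a ⊔ 0) := by
        rw [succ_nsmul]; abel
      rw [e1, add_sup, add_zero]
      refine sup_le ?_ (ih j)
      have := ih (j + 1)
      rw [succ_nsmul] at this
      convert this using 1; abel
  have := IsArchimedeanLGroup.eq_zero_of_forall_nsmul_le (a ⊔ 0) b le_sup_right
    (fun n => by simpa using gen n 0)
  exact sup_eq_right.1 this

end LGroup

/-! ### The divisible hull of a lattice-ordered group -/

/-- The divisible hull `G^d`, with the order of a lattice-ordered group defined below. -/
def DivHull (G : Type*) [AddCommGroup G] : Type _ := DivisibleHull G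

namespace DivHull

variable {G : Type*} [AddCommGroup G]

noncomputable instance : AddCommGroup (DivHull G) := inferInstanceAs (AddCommGroup (DivisibleHull G))
noncomputable instance : Module ℚ (DivHull G) := inferInstanceAs (Module ℚ (DivisibleHull G))

/-- The canonical map `G → G^d`. -/
noncomputable def of : G →+ DivHull G := DivisibleHull.coeAddMonoidHom G

theorem exists_nsmul_eq (x : DivHull G) : ∃ n : ℕ, 0 < n ∧ ∃ g : G, n • x = of g := by
  induction x using DivisibleHull.ind with
  | mk g s =>
    refine ⟨s, s.pos, g, ?_⟩
    change s.val • DivisibleHull.mk g s = DivisibleHull.mk g 1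
    rw [DivisibleHull.nsmul_mk, DivisibleHull.mk_eq_mk]
    exact ⟨1, by simp⟩

theorem eq_zero_of_nsmul {x : DivHull G} {n : ℕ} (hn : 0 < n) (h : n • x = 0) : x = 0 := by
  rw [← Nat.cast_smul_eq_nsmul ℚ] at h
  exact (smul_eq_zero.1 h).resolve_left (by positivity)

variable [Lattice G] [IsOrderedAddMonoid G]

theorem of_injective : Function.Injective (of : G → DivHull G) := by
  have : IsAddTorsionFree G := lgroup_torsionFree
  exact DivisibleHull.coe_injective

/-- `x ≤ y` in `G^d` if and only if some positive multiple of `y - x` lies in the positive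
cone of `G`. -/
noncomputable instance : PartialOrder (DivHull G) where
  le x y := ∃ n : ℕ, 0 < n ∧ ∃ g : G, 0 ≤ g ∧ n • (y - x) = of g
  le_refl x := ⟨1, one_pos, 0, le_rfl, by simp⟩
  le_trans := by
    rintro x y z ⟨n, hn, g, hg, e⟩ ⟨m, hm, h, hh, e'⟩
    refine ⟨n * m, Nat.mul_pos hn hm, m • g + n • h,
      add_nonneg (nsmul_nonneg hg m) (nsmul_nonneg hh n), ?_⟩
    rw [map_add, map_nsmul, map_nsmul, ← e, ← e', smul_smul, smul_smul, mul_comm m n,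
      ← nsmul_add]
    congr 1; abel
  le_antisymm := by
    rintro x y ⟨n, hn, g, hg, e⟩ ⟨m, hm, h, hh, e'⟩
    have h1 : (of (m • g + n • h) : DivHull G) = of 0 := by
      rw [map_add, map_nsmul, map_nsmul, ← e, ← e', smul_smul, smul_smul, mul_comm m n,
        ← nsmul_add, map_zero]
      simp
    have h2 := of_injective h1
    have h3 : m • g = 0 := le_antisymm
      (by rw [eq_neg_of_add_eq_zero_left h2]; exact neg_nonpos.2 (nsmul_nonneg hh n))
      (nsmul_nonneg hg m)
    have h4 : (m * n) • (y - x) = 0 := by rw [mul_smul, e, ← map_nsmul, h3, map_zero]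
    exact (sub_eq_zero.1 (eq_zero_of_nsmul (Nat.mul_pos hm hn) h4)).symm

theorem le_def {x y : DivHull G} :
    x ≤ y ↔ ∃ n : ℕ, 0 < n ∧ ∃ g : G, 0 ≤ g ∧ n • (y - x) = of g := Iff.rfl

instance : IsOrderedAddMonoid (DivHull G) where
  add_le_add_left := by
    rintro a b ⟨n, hn, g, hg, e⟩ c
    exact ⟨n, hn, g, hg, by rw [← e]; congr 1; abel⟩

theorem of_le_of {a b : G} : (of a : DivHull G) ≤ of b ↔ a ≤ b := by
  constructor
  · rintro ⟨n, hn, g, hg, e⟩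
    rw [← map_sub, ← map_nsmul] at e
    have h := of_injective e
    exact sub_nonneg.1 (lgroup_nonneg_of_nsmul_nonneg hn (h ▸ hg))
  · intro h
    exact ⟨1, one_pos, b - a, sub_nonneg.2 h, by simp⟩

theorem exists_le_of (x : DivHull G) : ∃ g : G, 0 ≤ g ∧ x ≤ of g := by
  obtain ⟨n, hn, g, e⟩ := exists_nsmul_eq x
  refine ⟨g ⊔ 0, le_sup_right, n, hn, n • (g ⊔ 0) - g, ?_, ?_⟩
  · refine sub_nonneg.2 ((le_sup_left : g ≤ g ⊔ 0).trans ?_)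
    simpa using nsmul_le_nsmul_left (le_sup_right : (0 : G) ≤ g ⊔ 0) (Nat.succ_le_of_lt hn)
  · rw [nsmul_sub, e, map_sub, map_nsmul]

instance : IsDirectedOrder (DivHull G) where
  directed x y := by
    obtain ⟨g, hg, hx⟩ := exists_le_of x
    obtain ⟨h, hh, hy⟩ := exists_le_of y
    exact ⟨of (g + h), hx.trans (of_le_of.2 (le_add_of_nonneg_right hh)),
      hy.trans (of_le_of.2 (le_add_of_nonneg_left hg))⟩

/-- The embedding of `G` in `G^d` preserves suprema. -/
theorem isLUB_of_sup (a b : G) : IsLUB {(of a : DivHull G), of b} (of (a ⊔ b)) := by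
  constructor
  · rintro x (rfl | rfl)
    · exact of_le_of.2 le_sup_left
    · exact of_le_of.2 le_sup_right
  · intro d hd
    obtain ⟨n, hn, h, e⟩ := exists_nsmul_eq d
    have aux : ∀ c : G, (of c : DivHull G) ≤ d → n • c ≤ h := by
      intro c hc
      have := nsmul_le_nsmul_right hc n
      rwa [e, ← map_nsmul, of_le_of] at this
    have h1 := lgroup_nsmul_sup_le hn (aux a (hd (by simp))) (aux b (hd (by simp)))
    exact ⟨n, hn, h - n • (a ⊔ b), sub_nonneg.2 h1, by rw [nsmul_sub, e, map_sub, map_nsmul]⟩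

end DivHull

/-- A partially ordered group in which `n a ≤ b` for all `n` implies `a ≤ 0`. -/
class IsIntegrallyClosedGroup (D : Type*) [AddCommGroup D] [PartialOrder D] : Prop where
  nonpos_of_forall_nsmul_le : ∀ a b : D, (∀ n : ℕ, n • a ≤ b) → a ≤ 0

instance {G : Type*} [AddCommGroup G] [Lattice G] [IsOrderedAddMonoid G]
    [IsArchimedeanLGroup G] : IsIntegrallyClosedGroup (DivHull G) where
  nonpos_of_forall_nsmul_le a b h := by
    obtain ⟨n, hn, g, e⟩ := DivHull.exists_nsmul_eq a
    obtain ⟨c, hc0, hc⟩ := DivHull.exists_le_of b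
    have h1 : g ≤ 0 := by
      refine lgroup_nonpos_of_forall_nsmul_le (b := n • c) fun k => ?_
      have := nsmul_le_nsmul_right ((h k).trans hc) n
      rwa [smul_comm, e, ← map_nsmul, ← map_nsmul, DivHull.of_le_of] at this
    exact ⟨n, hn, -g, neg_nonneg.2 h1, by simp [e]⟩

/-! ### The Dedekind–MacNeille completion of a partially ordered group -/

/-- The Dedekind–MacNeille completion of a directed partially ordered group: the Dedekind cuts
`(L, U)` with `L` and `U` nonempty, so that no largest and smallest elements are added. -/
def DMCompletion (D : Type*) [PartialOrder D] : Type _ :=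
  {A : DedekindCut D // A.left.Nonempty ∧ A.right.Nonempty}

namespace DMCompletion

section Order

variable {D : Type*} [PartialOrder D]

/-- The lower set of a cut. -/
def L (x : DMCompletion D) : Set D := x.1.left
/-- The upper set of a cut. -/
def U (x : DMCompletion D) : Set D := x.1.right

theorem L_nonempty (x : DMCompletion D) : x.L.Nonempty := x.2.1
theorem U_nonempty (x : DMCompletion D) : x.U.Nonempty := x.2.2

theorem mem_U {x : DMCompletion D} {w : D} : w ∈ x.U ↔ ∀ a ∈ x.L, a ≤ w := by
  rw [U, ← DedekindCut.upperBounds_left]; rfl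

theorem mem_L {x : DMCompletion D} {w : D} : w ∈ x.L ↔ ∀ b ∈ x.U, w ≤ b := by
  rw [L, ← DedekindCut.lowerBounds_right]; rfl

instance : PartialOrder (DMCompletion D) :=
  inferInstanceAs (PartialOrder
    {A : DedekindCut D // A.left.Nonempty ∧ A.right.Nonempty})

theorem le_iff_U {x y : DMCompletion D} : x ≤ y ↔ y.U ⊆ x.U :=
  (Concept.intent_subset_intent_iff (c := y.1) (d := x.1)).symm

theorem le_iff_L {x y : DMCompletion D} : x ≤ y ↔ x.L ⊆ y.L :=
  (Concept.extent_subset_extent_iff (c := x.1) (d := y.1)).symm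

theorem ext_U {x y : DMCompletion D} (h : x.U = y.U) : x = y := Subtype.ext (DedekindCut.ext' h)

/-- The supremum in the completion of a nonempty bounded above subset `S` of `D`. -/
def ofSet (S : Set D) (h : S.Nonempty) (h' : BddAbove S) : DMCompletion D :=
  ⟨Concept.ofObjects (· ≤ ·) S, h.mono (subset_lowerPolar_upperPolar _ S), h'⟩

theorem mem_U_ofSet {S : Set D} {h h'} {w : D} : w ∈ (ofSet S h h').U ↔ ∀ a ∈ S, a ≤ w := Iff.rfl

/-- The canonical map of `D` in its completion. -/
def of (d : D) : DMCompletion D := ⟨DedekindCut.principal d, ⟨d, le_rfl⟩, ⟨d, le_rfl⟩⟩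

theorem mem_U_of {d w : D} : w ∈ (of d).U ↔ d ≤ w := Iff.rfl
theorem mem_L_of {d w : D} : w ∈ (of d).L ↔ w ≤ d := Iff.rfl

theorem of_le_of {a b : D} : of a ≤ of b ↔ a ≤ b := DedekindCut.principal_le_principal

theorem of_le_iff {a : D} {x : DMCompletion D} : of a ≤ x ↔ a ∈ x.L := DedekindCut.principal_le_iff

theorem le_of_iff {a : D} {x : DMCompletion D} : x ≤ of a ↔ a ∈ x.U := DedekindCut.le_principal_iff

/-- The completion is conditionally complete. -/
theorem exists_isLUB (S : Set (DMCompletion D)) (h : S.Nonempty) (h' : BddAbove S) :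
    ∃ z, IsLUB S z := by
  obtain ⟨s, hs⟩ := h
  obtain ⟨b, hb⟩ := h'
  obtain ⟨u, hu⟩ := b.U_nonempty
  refine ⟨ofSet {d | ∃ s ∈ S, d ∈ s.L} ?_ ⟨u, ?_⟩, ?_, ?_⟩
  · obtain ⟨l, hl⟩ := s.L_nonempty
    exact ⟨l, s, hs, hl⟩
  · rintro d ⟨t, ht, hd⟩
    exact mem_U.1 (le_iff_U.1 (hb ht) hu) d hd
  · intro t ht
    rw [le_iff_U]
    intro w hw
    rw [mem_U]
    exact fun a ha => mem_U_ofSet.1 hw a ⟨t, ht, ha⟩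
  · intro t ht
    rw [le_iff_U]
    intro w hw
    refine mem_U_ofSet.2 ?_
    rintro a ⟨s', hs', ha⟩
    exact mem_U.1 (le_iff_U.1 (ht hs') hw) a ha

end Order

section Group

variable {D : Type*} [AddCommGroup D] [PartialOrder D] [IsOrderedAddMonoid D]

instance : Zero (DMCompletion D) := ⟨of 0⟩

/-- The sum of two cuts is the supremum of the sums of elements of their lower sets. -/
instance : Add (DMCompletion D) where
  add x y := ofSet {d | ∃ a ∈ x.L, ∃ b ∈ y.L, d = a + b}
    (by
      obtain ⟨a, ha⟩ := x.L_nonempty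
      obtain ⟨b, hb⟩ := y.L_nonempty
      exact ⟨a + b, a, ha, b, hb, rfl⟩)
    (by
      obtain ⟨u, hu⟩ := x.U_nonempty
      obtain ⟨v, hv⟩ := y.U_nonempty
      refine ⟨u + v, ?_⟩
      rintro d ⟨a, ha, b, hb, rfl⟩
      exact add_le_add (mem_U.1 hu a ha) (mem_U.1 hv b hb))

/-- The opposite of the cut `(L, U)` is `(-U, -L)`. -/
instance : Neg (DMCompletion D) where
  neg x := ofSet {d | -d ∈ x.U}
    (by
      obtain ⟨u, hu⟩ := x.U_nonempty
      exact ⟨-u, by simpa using hu⟩)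
    (by
      obtain ⟨l, hl⟩ := x.L_nonempty
      exact ⟨-l, fun d hd => le_neg_of_le_neg (mem_U.1 hd l hl)⟩)

theorem mem_U_add {x y : DMCompletion D} {w : D} :
    w ∈ (x + y).U ↔ ∀ a ∈ x.L, ∀ b ∈ y.L, a + b ≤ w := by
  refine mem_U_ofSet.trans ⟨fun h a ha b hb => h _ ⟨a, ha, b, hb, rfl⟩, ?_⟩
  rintro h d ⟨a, ha, b, hb, rfl⟩
  exact h a ha b hb

theorem mem_U_add' {x y : DMCompletion D} {w : D} :
    w ∈ (x + y).U ↔ ∀ b ∈ y.L, w - b ∈ x.U := by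
  rw [mem_U_add]
  exact ⟨fun h b hb => mem_U.2 fun a ha => le_sub_iff_add_le.2 (h a ha b hb),
    fun h a ha b hb => le_sub_iff_add_le.1 (mem_U.1 (h b hb) a ha)⟩

theorem mem_U_neg {x : DMCompletion D} {w : D} : w ∈ (-x).U ↔ -w ∈ x.L := by
  refine mem_U_ofSet.trans ?_
  rw [mem_L]
  refine ⟨fun h b hb => neg_le_of_neg_le (h (-b) (by simpa using hb)), fun h d hd => ?_⟩
  exact neg_le_neg_iff.1 (h (-d) hd)

protected theorem add_comm' (x y : DMCompletion D) : x + y = y + x := by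
  refine ext_U (Set.ext fun w => ?_)
  rw [mem_U_add, mem_U_add]
  exact ⟨fun h a ha b hb => add_comm b a ▸ h b hb a ha,
    fun h a ha b hb => add_comm b a ▸ h b hb a ha⟩

protected theorem mem_U_add_add {x y z : DMCompletion D} {w : D} :
    w ∈ (x + y + z).U ↔ ∀ a ∈ x.L, ∀ b ∈ y.L, ∀ c ∈ z.L, a + b + c ≤ w := by
  rw [mem_U_add']
  refine ⟨fun h a ha b hb c hc => le_sub_iff_add_le.1 (mem_U_add.1 (h c hc) a ha b hb),
    fun h c hc => mem_U_add.2 fun a ha b hb => le_sub_iff_add_le.2 (h a ha b hb c hc)⟩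

theorem of_add (a b : D) : of (a + b) = of a + of b := by
  refine ext_U (Set.ext fun w => ?_)
  rw [mem_U_add, mem_U_of]
  exact ⟨fun h c hc d hd => (add_le_add hc hd).trans h, fun h => h a le_rfl b le_rfl⟩

variable [IsIntegrallyClosedGroup D]

noncomputable instance : AddCommGroup (DMCompletion D) where
  add_assoc x y z := by
    refine ext_U (Set.ext fun w => ?_)
    rw [DMCompletion.add_comm' x (y + z), DMCompletion.mem_U_add_add, DMCompletion.mem_U_add_add]
    refine ⟨fun h b hb c hc a ha => ?_, fun h a ha b hb c hc => ?_⟩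
    · have := h a ha b hb c hc
      rwa [add_assoc, add_comm] at this
    · have := h b hb c hc a ha
      rwa [add_assoc, add_comm]
  zero_add x := by
    refine ext_U (Set.ext fun w => ?_)
    rw [mem_U_add, mem_U]
    refine ⟨fun h a ha => by simpa using h 0 le_rfl a ha, fun h a ha b hb => ?_⟩
    have ha' : a ≤ 0 := ha
    simpa using add_le_add ha' (h b hb)
  add_zero x := by
    rw [DMCompletion.add_comm']
    refine ext_U (Set.ext fun w => ?_)
    rw [mem_U_add, mem_U]
    refine ⟨fun h a ha => by simpa using h 0 le_rfl a ha, fun h a ha b hb => ?_⟩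
    have ha' : a ≤ 0 := ha
    simpa using add_le_add ha' (h b hb)
  add_comm := DMCompletion.add_comm'
  nsmul := nsmulRec
  zsmul := zsmulRec
  neg_add_cancel x := by
    refine ext_U (Set.ext fun w => ?_)
    rw [mem_U_add]
    refine Iff.trans ⟨fun h => ?_, fun h a ha b hb => ?_⟩ (mem_U_of (d := (0 : D))).symm
    · have step : ∀ b ∈ x.L, b + -w ∈ x.L := by
        intro b hb
        refine mem_L.2 fun u hu => ?_
        have h1 : -u ∈ (-x).L := mem_L.2 fun v hv => by
          simpa using neg_le_neg (mem_L.1 (mem_U_neg.1 hv) u hu)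
        have := h (-u) h1 b hb
        rw [add_neg_le_iff_le_add]
        rw [neg_add_le_iff_le_add] at this
        exact this
      obtain ⟨l, hl⟩ := x.L_nonempty
      obtain ⟨u, hu⟩ := x.U_nonempty
      have h2 : ∀ n : ℕ, l + n • (-w) ∈ x.L := by
        intro n
        induction n with
        | zero => simpa using hl
        | succ n ih => rw [succ_nsmul, ← add_assoc]; exact step _ ih
      have h3 := IsIntegrallyClosedGroup.nonpos_of_forall_nsmul_le (-w) (u - l)
        fun n => le_sub_iff_add_le'.2 (mem_U.1 hu _ (h2 n))
      exact neg_nonpos.1 h3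
    · have h1 : -b ∈ (-x).U := mem_U_neg.2 (by simpa using hb)
      have h2 := mem_U.1 h1 a ha
      exact (le_neg_iff_add_nonpos_right.1 h2).trans h

theorem of_nsmul (n : ℕ) (a : D) : of (n • a) = n • of a := by
  induction n with
  | zero => rw [zero_nsmul, zero_nsmul]; rfl
  | succ n ih => rw [succ_nsmul, succ_nsmul, of_add, ih]

instance : IsOrderedAddMonoid (DMCompletion D) where
  add_le_add_left x y h z := by
    rw [le_iff_U]
    intro w hw
    rw [mem_U_add] at hw ⊢
    exact fun a ha b hb => hw a (le_iff_L.1 h ha) b hb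

variable [IsDirectedOrder D]

instance : Lattice (DMCompletion D) where
  sup x y := ⟨x.1 ⊔ y.1, x.2.1.mono (Concept.extent_subset_extent_iff.2 le_sup_left), by
    obtain ⟨u, hu⟩ := x.U_nonempty
    obtain ⟨v, hv⟩ := y.U_nonempty
    obtain ⟨w, huw, hvw⟩ := exists_ge_ge u v
    exact ⟨w, mem_U.2 fun a ha => (mem_U.1 hu a ha).trans huw,
      mem_U.2 fun a ha => (mem_U.1 hv a ha).trans hvw⟩⟩
  inf x y := ⟨x.1 ⊓ y.1, by
    obtain ⟨u, hu⟩ := x.L_nonempty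
    obtain ⟨v, hv⟩ := y.L_nonempty
    obtain ⟨w, huw, hvw⟩ := exists_ge_ge (-u) (-v)
    exact ⟨-w, mem_L.2 fun a ha => (neg_le_of_neg_le huw).trans (mem_L.1 hu a ha),
      mem_L.2 fun a ha => (neg_le_of_neg_le hvw).trans (mem_L.1 hv a ha)⟩,
    x.2.2.mono (Concept.intent_subset_intent_iff.2 inf_le_left)⟩
  le_sup_left x y := (le_sup_left : x.1 ≤ x.1 ⊔ y.1)
  le_sup_right x y := (le_sup_right : y.1 ≤ x.1 ⊔ y.1)
  sup_le x y z h h' := (sup_le h h' : x.1 ⊔ y.1 ≤ z.1)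
  inf_le_left x y := (inf_le_left : x.1 ⊓ y.1 ≤ x.1)
  inf_le_right x y := (inf_le_right : x.1 ⊓ y.1 ≤ y.1)
  le_inf x y z h h' := (le_inf h h' : x.1 ≤ y.1 ⊓ z.1)

theorem of_sup {a b c : D} (h : IsLUB {a, b} c) : of c = of a ⊔ of b := by
  refine le_antisymm ?_ (sup_le (of_le_of.2 (h.1 (by simp))) (of_le_of.2 (h.1 (by simp))))
  rw [le_iff_U]
  intro w hw
  rw [← le_of_iff, sup_le_iff, of_le_of, of_le_of] at hw
  refine mem_U_of.2 (h.2 ?_)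
  rintro x (rfl | rfl)
  exacts [hw.1, hw.2]

theorem exists_nsmul_eq [Module ℚ D] (x : DMCompletion D) {n : ℕ} (hn : 0 < n) :
    ∃ y : DMCompletion D, n • y = x := by
  have div : ∀ d : D, n • ((n : ℚ)⁻¹ • d) = d := fun d => by
    rw [← Nat.cast_smul_eq_nsmul ℚ, smul_smul, mul_inv_cancel₀ (by positivity), one_smul]
  have cancel : ∀ a b : D, n • a ≤ n • b → a ≤ b := fun a b h => by
    rw [← of_le_of, of_nsmul, of_nsmul] at h
    exact of_le_of.1 (lgroup_le_of_nsmul_le hn h)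
  have ub : ∀ u ∈ x.U, (n : ℚ)⁻¹ • u ∈ upperBounds {d | n • d ∈ x.L} := fun u hu d hd =>
    cancel _ _ (by rw [div]; exact mem_U.1 hu _ hd)
  refine ⟨ofSet {d | n • d ∈ x.L} ?_ ?_, le_antisymm ?_ ?_⟩
  · obtain ⟨l, hl⟩ := x.L_nonempty
    exact ⟨(n : ℚ)⁻¹ • l, by rw [Set.mem_ofPred_eq, div]; exact hl⟩
  · obtain ⟨u, hu⟩ := x.U_nonempty
    exact ⟨_, ub u hu⟩
  · rw [le_iff_U]
    intro u hu
    rw [← le_of_iff, ← div u, of_nsmul]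
    exact nsmul_le_nsmul_right (le_of_iff.2 (mem_U_ofSet.2 (ub u hu))) n
  · rw [le_iff_L]
    intro l hl
    rw [← of_le_iff, ← div l, of_nsmul]
    refine nsmul_le_nsmul_right (of_le_iff.2 (mem_L.2 fun w hw => ?_)) n
    exact mem_U_ofSet.1 hw _ (by rw [Set.mem_ofPred_eq, div]; exact hl)

end Group

end DMCompletion

/-! ### Real scalars in a divisible conditionally complete lattice-ordered group -/

section RealScalars

variable {C : Type*} [AddCommGroup C] [Lattice C] [IsOrderedAddMonoid C]

/-- `IsRealMultiple r x z` says that `z = r x`: the elements `n z - ⌊n r⌋ x`, for `n` an integer,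
are bounded in the lattice-ordered group. -/
def IsRealMultiple (r : ℝ) (x z : C) : Prop :=
  ∃ u : C, ∀ n : ℤ, |n • z - ⌊n * r⌋ • x| ≤ u

theorem abs_zsmul_le_of_le (x : C) (j : ℤ) (K : ℕ) (h : |j| ≤ K) : |j • x| ≤ K • |x| := by
  have h0 : ∀ k : ℕ, |k • x| ≤ k • |x| := by
    intro k
    induction k with
    | zero => simp
    | succ k ih =>
      rw [succ_nsmul, succ_nsmul]
      exact (abs_add_le _ _).trans (add_le_add_left ih _)
  have h1 : |j • x| ≤ j.natAbs • |x| := by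
    rcases Int.natAbs_eq j with e | e
    · conv_lhs => rw [e, natCast_zsmul]
      exact h0 _
    · conv_lhs => rw [e, neg_smul, natCast_zsmul, abs_neg]
      exact h0 _
  exact h1.trans (nsmul_le_nsmul_left (abs_nonneg x)
    (by rw [Int.abs_eq_natAbs] at h; exact_mod_cast h))

theorem IsRealMultiple.bound {r : ℝ} {x z : C} (h : IsRealMultiple r x z) (K : ℕ) :
    ∃ u : C, ∀ n m : ℤ, |n * r - m| ≤ K → |n • z - m • x| ≤ u := by
  obtain ⟨u, hu⟩ := h
  refine ⟨u + (K + 1) • |x|, fun n m hm => ?_⟩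
  have e : n • z - m • x = (n • z - ⌊n * r⌋ • x) + (⌊n * r⌋ - m) • x := by rw [sub_smul]; abel
  rw [e]
  refine (abs_add_le _ _).trans (add_le_add (hu n) (abs_zsmul_le_of_le _ _ _ ?_))
  have h1 := Int.floor_le (n * r)
  have h2 := Int.lt_floor_add_one (n * r)
  rw [abs_le] at hm
  have : |((⌊n * r⌋ - m : ℤ) : ℝ)| ≤ ((K + 1 : ℕ) : ℤ) := by
    push_cast
    rw [abs_le]
    constructor <;> linarith [hm.1, hm.2]
  exact_mod_cast this

theorem abs_floor_sub_le (s : ℝ) : |s - ⌊s⌋| ≤ (1 : ℕ) := by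
  have h1 := Int.floor_le s
  have h2 := Int.lt_floor_add_one s
  rw [abs_le]; push_cast
  constructor <;> linarith

theorem IsRealMultiple.add_right {r : ℝ} {x y z w : C} (h : IsRealMultiple r x z)
    (h' : IsRealMultiple r y w) : IsRealMultiple r (x + y) (z + w) := by
  obtain ⟨u, hu⟩ := h
  obtain ⟨v, hv⟩ := h'
  refine ⟨u + v, fun n => ?_⟩
  have e : n • (z + w) - ⌊n * r⌋ • (x + y)
      = (n • z - ⌊n * r⌋ • x) + (n • w - ⌊n * r⌋ • y) := by
    rw [smul_add, smul_add]; abel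
  rw [e]
  exact (abs_add_le _ _).trans (add_le_add (hu n) (hv n))

theorem IsRealMultiple.neg_right {r : ℝ} {x z : C} (h : IsRealMultiple r x z) :
    IsRealMultiple r (-x) (-z) := by
  obtain ⟨u, hu⟩ := h
  refine ⟨u, fun n => ?_⟩
  rw [smul_neg, smul_neg, ← neg_sub', abs_neg]
  exact hu n

theorem IsRealMultiple.add_left {r s : ℝ} {x z w : C} (h : IsRealMultiple r x z)
    (h' : IsRealMultiple s x w) : IsRealMultiple (r + s) x (z + w) := by
  obtain ⟨u, hu⟩ := h
  obtain ⟨v, hv⟩ := h'.bound 2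
  refine ⟨u + v, fun n => ?_⟩
  have e : n • (z + w) - ⌊n * (r + s)⌋ • x
      = (n • z - ⌊n * r⌋ • x) + (n • w - (⌊n * (r + s)⌋ - ⌊n * r⌋) • x) := by
    rw [smul_add, sub_smul]; abel
  rw [e]
  refine (abs_add_le _ _).trans (add_le_add (hu n) (hv n _ ?_))
  have h1 := abs_le.1 (abs_floor_sub_le (n * r))
  have h2 := abs_le.1 (abs_floor_sub_le (n * (r + s)))
  push_cast at h1 h2 ⊢
  rw [abs_le]
  constructor <;> nlinarith

theorem IsRealMultiple.mul {r s : ℝ} {x z w : C} (h : IsRealMultiple s x w)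
    (h' : IsRealMultiple r w z) : IsRealMultiple (r * s) x z := by
  obtain ⟨v, hv⟩ := h'
  obtain ⟨u, hu⟩ := h.bound (⌈|s|⌉₊ + 1)
  refine ⟨v + u, fun n => ?_⟩
  have e : n • z - ⌊n * (r * s)⌋ • x
      = (n • z - ⌊n * r⌋ • w) + (⌊n * r⌋ • w - ⌊n * (r * s)⌋ • x) := by abel
  rw [e]
  refine (abs_add_le _ _).trans (add_le_add (hv n) (hu _ _ ?_))
  have h1 := abs_floor_sub_le (n * r)
  have h2 := abs_floor_sub_le (n * (r * s))
  have h3 : (⌊n * r⌋ : ℝ) * s - ⌊n * (r * s)⌋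
      = -((n * r - ⌊n * r⌋) * s) + (n * (r * s) - ⌊n * (r * s)⌋) := by ring
  rw [h3]
  refine (abs_add_le _ _).trans ?_
  rw [abs_neg, abs_mul]
  have h4 := Nat.le_ceil |s|
  push_cast at h1 h2 ⊢
  nlinarith [abs_nonneg s, abs_nonneg (n * r - ⌊n * r⌋)]

theorem isRealMultiple_one (x : C) : IsRealMultiple 1 x x :=
  ⟨0, fun n => by simp⟩

theorem nonpos_of_forall_nsmul_le_of_complete
    (hcc : ∀ S : Set C, S.Nonempty → BddAbove S → ∃ z, IsLUB S z) {a b : C}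
    (h : ∀ n : ℕ, n • a ≤ b) : a ≤ 0 := by
  obtain ⟨s, hs⟩ := hcc (Set.range fun n : ℕ => n • a) ⟨_, 0, rfl⟩
    ⟨b, by rintro _ ⟨n, rfl⟩; exact h n⟩
  have : s ≤ s - a := hs.2 (by
    rintro _ ⟨n, rfl⟩
    have := hs.1 ⟨n + 1, rfl⟩
    simp only [succ_nsmul] at this
    exact le_sub_iff_add_le.2 this)
  simpa using this

theorem IsRealMultiple.unique
    (hcc : ∀ S : Set C, S.Nonempty → BddAbove S → ∃ z, IsLUB S z) {r : ℝ} {x z w : C}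
    (h : IsRealMultiple r x z) (h' : IsRealMultiple r x w) : z = w := by
  have key : ∀ z w : C, IsRealMultiple r x z → IsRealMultiple r x w → z ≤ w := by
    rintro z w ⟨u, hu⟩ ⟨v, hv⟩
    refine sub_nonpos.1 (nonpos_of_forall_nsmul_le_of_complete hcc (b := u + v) fun n => ?_)
    have e : n • (z - w) = ((n : ℤ) • z - ⌊(n : ℤ) * r⌋ • x)
        + -((n : ℤ) • w - ⌊(n : ℤ) * r⌋ • x) := by
      rw [nsmul_sub, natCast_zsmul, natCast_zsmul]; abel
    rw [e]
    exact add_le_add ((le_abs_self _).trans (hu n)) ((neg_le_abs _).trans (hv n))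
  exact le_antisymm (key z w h h') (key w z h' h)

theorem IsRealMultiple.nonneg
    (hcc : ∀ S : Set C, S.Nonempty → BddAbove S → ∃ z, IsLUB S z) {r : ℝ} {x z : C}
    (h : IsRealMultiple r x z) (hr : 0 ≤ r) (hx : 0 ≤ x) : 0 ≤ z := by
  obtain ⟨u, hu⟩ := h
  refine neg_nonpos.1 (nonpos_of_forall_nsmul_le_of_complete hcc (b := u) fun n => ?_)
  have h1 := (neg_le_abs _).trans (hu n)
  have h2 : (0 : C) ≤ ⌊(n : ℤ) * r⌋ • x :=
    zsmul_nonneg hx (Int.floor_nonneg.2 (mul_nonneg (by positivity) hr))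
  rw [neg_sub, natCast_zsmul] at h1
  rw [smul_neg]
  refine le_trans ?_ h1
  rw [sub_eq_add_neg]
  exact le_add_of_nonneg_left h2

theorem exists_isRealMultiple
    (hcc : ∀ S : Set C, S.Nonempty → BddAbove S → ∃ z, IsLUB S z)
    (hdiv : ∀ (x : C) {n : ℕ}, 0 < n → ∃ y, n • y = x) (r : ℝ) (x : C) :
    ∃ z, IsRealMultiple r x z := by
  -- it suffices to treat a positive element
  suffices pos : ∀ x : C, 0 ≤ x → ∃ z, IsRealMultiple r x z by
    obtain ⟨z, hz⟩ := pos x⁺ (posPart_nonneg x)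
    obtain ⟨w, hw⟩ := pos x⁻ (negPart_nonneg x)
    refine ⟨z + -w, ?_⟩
    have := hz.add_right hw.neg_right
    rwa [← sub_eq_add_neg, posPart_sub_negPart] at this
  clear x
  intro x hx
  set S : Set C := {y | ∃ (m : ℤ) (n : ℕ), 0 < n ∧ m ≤ n * r ∧ n • y = m • x} with hS
  have ub : ∀ (y y' : C) (n : ℕ) (j : ℤ), y ∈ S → 0 < n → n • y' = j • x → n * r ≤ j →
      y ≤ y' := by
    rintro y y' n j ⟨i, k, hk, hi, e⟩ hn e' hj
    refine lgroup_le_of_nsmul_le (Nat.mul_pos hk hn) ?_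
    have e1 : (k * n) • y = (n * i) • x := by
      rw [mul_comm, mul_smul, e, mul_smul, natCast_zsmul]
    have e2 : (k * n) • y' = (k * j) • x := by
      rw [mul_smul, e', mul_smul, natCast_zsmul]
    rw [e1, e2]
    refine zsmul_le_zsmul_left hx ?_
    have hk' : (0 : ℝ) < k := by exact_mod_cast hk
    have hn' : (0 : ℝ) < n := by exact_mod_cast hn
    have : (n * i : ℝ) ≤ k * j := by nlinarith
    exact_mod_cast this
  obtain ⟨z, hz⟩ := hcc S ⟨⌊r⌋ • x, ⌊r⌋, 1, one_pos, by simpa using Int.floor_le r, by simp⟩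
    ⟨(⌊r⌋ + 1) • x, fun y hy => ub y _ 1 (⌊r⌋ + 1) hy one_pos (by simp)
      (by push_cast; linarith [Int.lt_floor_add_one r])⟩
  have main : ∀ n : ℕ, 0 < n → |n • z - ⌊n * r⌋ • x| ≤ x := by
    intro n hn
    obtain ⟨y, hy⟩ := hdiv (⌊n * r⌋ • x) hn
    obtain ⟨y', hy'⟩ := hdiv ((⌊n * r⌋ + 1) • x) hn
    have h1 : y ≤ z := hz.1 ⟨_, n, hn, Int.floor_le _, hy⟩
    have h2 : z ≤ y' := hz.2 fun w hw => ub w y' n _ hw hn hy'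
      (by push_cast; linarith [Int.lt_floor_add_one (n * r)])
    have h3 : ⌊n * r⌋ • x ≤ n • z := hy ▸ nsmul_le_nsmul_right h1 n
    have h4 : n • z ≤ (⌊n * r⌋ + 1) • x := hy' ▸ nsmul_le_nsmul_right h2 n
    rw [abs_of_nonneg (sub_nonneg.2 h3), sub_le_iff_le_add, add_comm x]
    rwa [add_smul, one_smul] at h4
  refine ⟨z, x + 2 • |x|, fun n => ?_⟩
  have hxx : x ≤ x + 2 • |x| := le_add_of_nonneg_right (nsmul_nonneg (abs_nonneg x) 2)
  rcases lt_trichotomy n 0 with hn | rfl | hn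
  · obtain ⟨k, rfl⟩ : ∃ k : ℕ, n = -(k : ℤ) := ⟨n.natAbs, by omega⟩
    have e : (-(k : ℤ)) • z - ⌊((-(k : ℤ) : ℤ) : ℝ) * r⌋ • x
        = -(k • z - ⌊k * r⌋ • x) + (-⌊k * r⌋ - ⌊((-(k : ℤ) : ℤ) : ℝ) * r⌋) • x := by
      rw [neg_smul, natCast_zsmul, sub_smul, neg_smul]; abel
    rw [e]
    refine (abs_add_le _ _).trans (add_le_add ?_ (abs_zsmul_le_of_le _ _ _ ?_))
    · rw [abs_neg]; exact main k (by omega)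
    · have h1 := Int.floor_le (k * r)
      have h2 := Int.lt_floor_add_one (k * r)
      have h3 := Int.floor_le (((-(k : ℤ) : ℤ) : ℝ) * r)
      have h4 := Int.lt_floor_add_one (((-(k : ℤ) : ℤ) : ℝ) * r)
      have : |((-⌊k * r⌋ - ⌊((-(k : ℤ) : ℤ) : ℝ) * r⌋ : ℤ) : ℝ)| ≤ ((2 : ℕ) : ℤ) := by
        push_cast at h3 h4 ⊢
        rw [abs_le]
        constructor <;> linarith
      exact_mod_cast this
  · simpa using hx.trans hxx
  · obtain ⟨k, rfl⟩ : ∃ k : ℕ, n = (k : ℤ) := ⟨n.natAbs, by omega⟩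
    have := main k (by omega)
    rw [natCast_zsmul]
    exact_mod_cast this.trans hxx

end RealScalars

namespace DMCompletion

variable {D : Type*} [AddCommGroup D] [PartialOrder D] [IsOrderedAddMonoid D]
  [IsIntegrallyClosedGroup D] [IsDirectedOrder D] [Module ℚ D]

/-- Multiplication by a real scalar in the completion of a divisible group. -/
noncomputable instance : SMul ℝ (DMCompletion D) where
  smul r x := (exists_isRealMultiple exists_isLUB exists_nsmul_eq r x).choose

theorem isRealMultiple_smul (r : ℝ) (x : DMCompletion D) : IsRealMultiple r x (r • x) :=
  (exists_isRealMultiple exists_isLUB exists_nsmul_eq r x).choose_spec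

theorem smul_eq_of_isRealMultiple {r : ℝ} {x z : DMCompletion D} (h : IsRealMultiple r x z) :
    r • x = z :=
  (isRealMultiple_smul r x).unique exists_isLUB h

noncomputable instance : Module ℝ (DMCompletion D) where
  one_smul x := smul_eq_of_isRealMultiple (isRealMultiple_one x)
  mul_smul r s x := smul_eq_of_isRealMultiple
    ((isRealMultiple_smul s x).mul (isRealMultiple_smul r (s • x)))
  smul_zero r := smul_eq_of_isRealMultiple ⟨0, fun n => by simp⟩
  smul_add r x y := smul_eq_of_isRealMultiple
    ((isRealMultiple_smul r x).add_right (isRealMultiple_smul r y))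
  add_smul r s x := smul_eq_of_isRealMultiple
    ((isRealMultiple_smul r x).add_left (isRealMultiple_smul s x))
  zero_smul x := smul_eq_of_isRealMultiple ⟨0, fun n => by simp⟩

theorem smul_nonneg' {r : ℝ} {x : DMCompletion D} (hr : 0 ≤ r) (hx : 0 ≤ x) : 0 ≤ r • x :=
  (isRealMultiple_smul r x).nonneg exists_isLUB hr hx

instance : IsOrderedModule ℝ (DMCompletion D) where
  smul_le_smul_of_nonneg_left r hr x y h := by
    have := smul_nonneg' hr (sub_nonneg.2 h)
    rwa [smul_sub, sub_nonneg] at this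
  smul_le_smul_of_nonneg_right x hx r s h := by
    have := smul_nonneg' (sub_nonneg.2 h) hx
    rwa [sub_smul, sub_nonneg] at this

end DMCompletion

/-! ### The vector lattice cover -/

section Cover

variable (G : Type*) [AddCommGroup G] [Lattice G] [IsOrderedAddMonoid G] [IsArchimedeanLGroup G]

/-- The canonical embedding of `G` in the Dedekind–MacNeille completion of its divisible hull. -/
noncomputable def completionOf : G →+ DMCompletion (DivHull G) where
  toFun g := DMCompletion.of (DivHull.of g)
  map_zero' := by rw [map_zero]; rfl
  map_add' a b := by rw [map_add, DMCompletion.of_add]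

/-- The ℓ-subspace (vector sublattice) of the completion generated by `G`. -/
noncomputable def coverSubspace : Submodule ℝ (DMCompletion (DivHull G)) :=
  sInf {W | (∀ g, completionOf G g ∈ W) ∧ SupClosed (W : Set (DMCompletion (DivHull G))) ∧
    InfClosed (W : Set (DMCompletion (DivHull G)))}

theorem supClosed_coverSubspace ⦃x y : DMCompletion (DivHull G)⦄ (hx : x ∈ coverSubspace G)
    (hy : y ∈ coverSubspace G) : x ⊔ y ∈ coverSubspace G := by
  rw [coverSubspace, Submodule.mem_sInf] at *
  exact fun W hW => hW.2.1 (hx W hW) (hy W hW)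

theorem infClosed_coverSubspace ⦃x y : DMCompletion (DivHull G)⦄ (hx : x ∈ coverSubspace G)
    (hy : y ∈ coverSubspace G) : x ⊓ y ∈ coverSubspace G := by
  rw [coverSubspace, Submodule.mem_sInf] at *
  exact fun W hW => hW.2.2 (hx W hW) (hy W hW)

/-- The vector lattice cover `R[G]` of an archimedean lattice-ordered group `G`. -/
abbrev VectorLatticeCover : Type _ := ↥(coverSubspace G)

namespace VectorLatticeCover

noncomputable instance : Lattice (VectorLatticeCover G) :=
  Subtype.lattice (supClosed_coverSubspace G) (infClosed_coverSubspace G)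

instance : IsOrderedAddMonoid (VectorLatticeCover G) where
  add_le_add_left x y h z := add_le_add_left (show x.1 ≤ y.1 from h) z.1

instance : IsOrderedModule ℝ (VectorLatticeCover G) where
  smul_le_smul_of_nonneg_left r hr x y h := show r • x.1 ≤ r • y.1 from
    smul_le_smul_of_nonneg_left (show x.1 ≤ y.1 from h) hr
  smul_le_smul_of_nonneg_right x hx r s h := show r • x.1 ≤ s • x.1 from
    smul_le_smul_of_nonneg_right h (show 0 ≤ x.1 from hx)

variable {G}

/-- The canonical embedding of `G` in `R[G]`. -/
noncomputable def of : G →+ VectorLatticeCover G where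
  toFun g := ⟨completionOf G g, by
    rw [coverSubspace, Submodule.mem_sInf]
    exact fun W hW => hW.1 g⟩
  map_zero' := Subtype.ext (map_zero _)
  map_add' a b := Subtype.ext (map_add _ a b)

theorem of_le_of {a b : G} : of a ≤ of b ↔ a ≤ b :=
  DMCompletion.of_le_of.trans DivHull.of_le_of

theorem of_injective : Function.Injective (of : G → VectorLatticeCover G) := fun _ _ h =>
  le_antisymm (of_le_of.1 h.le) (of_le_of.1 h.ge)

theorem of_sup (a b : G) : of (a ⊔ b) = of a ⊔ of b :=
  Subtype.ext (DMCompletion.of_sup (DivHull.isLUB_of_sup a b))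

theorem of_inf (a b : G) : of (a ⊓ b) = of a ⊓ of b := by
  have h : a ⊓ b = -(-a ⊔ -b) := by rw [neg_sup, neg_neg, neg_neg]
  rw [h, map_neg, of_sup, map_neg, map_neg, neg_sup, neg_neg, neg_neg]

end VectorLatticeCover

end Cover

/-! ### Disjointness in lattice-ordered groups -/

section Disjointness

variable {A : Type*} [AddCommGroup A] [Lattice A] [IsOrderedAddMonoid A]

/-! In an archimedean f-algebra with unit `e` the order determines squares: `(x - r e)² ≥ 0` puts
every tangent `2 r x - r² e` below `x²`, and `x²` is the supremum of the tangents with rational `r`.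
For squares of positive elements of `G` this is `isSupTangents_mul_self`. The supremum exists for
every `x` in the completion of `G^d`, because the completion is conditionally complete and `|x|`
lies below some element of `G`. It defines a map `q`; tangents alone yield the parallelogram law,
and Jordan–von Neumann polarization turns `q` into a positive symmetric bilinear product with unit
`e` (`exists_mul_of_isSupTangents`). The estimate `c ≤ n e + q(c) / n` shows that this product
preserves disjointness. It extends the product of `G` because squares of positive elements agree and
`G` is commutative (`mul_comm_of_archimedean`).

Commutativity and the supremum formula share one device. If a quantity is bounded through the
distance from `h ≥ 0` to each of the integers `0, …, k`, then it is bounded through `1` and `(h -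
k)⁺` only; as `k (h - k)⁺ ≤ h²`, the archimedean property removes the second term as `k` grows.

Multiplication by a positive element is a lattice homomorphism. So the elements sent into `R[G]`
form a vector sublattice, which makes `R[G]` closed under the product, and two such operators on
`R[G]` coincide once they agree on `G` (`linearMap_ext`). This gives associativity, and the unit law
for every f-algebra product extending that of `G`. -/

theorem inf_add_eq_zero_of_inf_eq_zero {a b c : A} (hb : a ⊓ b = 0) (hc : a ⊓ c = 0) :
    a ⊓ (b + c) = 0 := by
  have ha0 : 0 ≤ a := hb ▸ inf_le_left
  have hb0 : 0 ≤ b := hb ▸ inf_le_right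
  have hc0 : 0 ≤ c := hc ▸ inf_le_right
  refine le_antisymm ?_ (le_inf ha0 (add_nonneg hb0 hc0))
  have h1 : a ⊓ (b + c) - c ≤ a ⊓ b :=
    le_inf ((sub_le_self _ hc0).trans inf_le_left) (sub_le_iff_le_add.2 inf_le_right)
  rw [hb, sub_nonpos] at h1
  exact hc ▸ le_inf inf_le_left h1

theorem nsmul_inf_eq_zero {a b : A} (h : a ⊓ b = 0) (n : ℕ) : (n • a) ⊓ b = 0 := by
  have hb : 0 ≤ b := h ▸ inf_le_right
  induction n with
  | zero => simpa using hb
  | succ n ih =>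
    rw [inf_comm] at ih h ⊢
    rw [succ_nsmul]
    exact inf_add_eq_zero_of_inf_eq_zero ih h

variable {B : Type*} [AddCommGroup B] [Lattice B] [IsOrderedAddMonoid B]

/-- The elements `x ⊔ y - x` and `x ⊔ y - y` are disjoint, and the infimum of their images is `T (x
⊔ y) - T x ⊔ T y`. -/
theorem map_sup_of_map_inf_eq_zero (T : A →+ B) (hT : ∀ a b, a ⊓ b = 0 → T a ⊓ T b = 0)
    (x y : A) : T (x ⊔ y) = T x ⊔ T y := by
  have h := hT (x ⊔ y - x) (x ⊔ y - y) (by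
    rw [sub_eq_add_neg, sub_eq_add_neg, ← add_inf, ← neg_sup, add_neg_cancel])
  rwa [map_sub, map_sub, sub_eq_add_neg, sub_eq_add_neg, ← add_inf, ← neg_sup,
    add_neg_eq_zero] at h

theorem map_inf_of_map_inf_eq_zero (T : A →+ B) (hT : ∀ a b, a ⊓ b = 0 → T a ⊓ T b = 0)
    (x y : A) : T (x ⊓ y) = T x ⊓ T y := by
  have h := map_sup_of_map_inf_eq_zero T hT (-x) (-y)
  rwa [← neg_inf, map_neg, map_neg, map_neg, ← neg_inf, neg_inj] at h

theorem map_sup_of_inf_eq_zero (T : A →+ A) (hT : ∀ a b, a ⊓ b = 0 → T a ⊓ b = 0) (x y : A) :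
    T (x ⊔ y) = T x ⊔ T y :=
  map_sup_of_map_inf_eq_zero T (fun a b h => by
    have h1 := hT a b h
    rw [inf_comm] at h1 ⊢
    exact hT b _ h1) x y

end Disjointness

/-! ### Unital f-rings -/

namespace IsFRing

variable {G : Type*} [Ring G] [Lattice G] [IsOrderedAddMonoid G] [IsFRing G]

theorem mul_le_mul {a b c d : G} (hb : 0 ≤ b) (hc : 0 ≤ c) (h : a ≤ b) (h' : c ≤ d) :
    a * c ≤ b * d := by
  have h1 := mul_nonneg (b - a) c (sub_nonneg.2 h) hc
  have h2 := mul_nonneg b (d - c) hb (sub_nonneg.2 h')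
  rw [sub_mul, sub_nonneg] at h1
  rw [mul_sub, sub_nonneg] at h2
  exact h1.trans h2

/-- Applying the f-ring axiom once on each side makes `a * b` disjoint from itself. -/
theorem mul_eq_zero_of_inf_eq_zero {a b : G} (h : a ⊓ b = 0) : a * b = 0 := by
  have ha : 0 ≤ a := h ▸ inf_le_left
  have hb : 0 ≤ b := h ▸ inf_le_right
  have h1 := mul_right_inf_eq_zero a b b h hb
  rw [inf_comm] at h1
  simpa using mul_left_inf_eq_zero b (a * b) a h1 ha

theorem mul_self_eq_add (a : G) : a * a = a⁺ * a⁺ + a⁻ * a⁻ := by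
  have h := posPart_inf_negPart_eq_zero a
  have h' := h
  rw [inf_comm] at h'
  conv_lhs => rw [← posPart_sub_negPart a]
  rw [sub_mul, mul_sub, mul_sub, mul_eq_zero_of_inf_eq_zero h, mul_eq_zero_of_inf_eq_zero h']
  abel

theorem mul_self_nonneg (a : G) : 0 ≤ a * a := by
  rw [mul_self_eq_add]
  exact add_nonneg (mul_nonneg _ _ (posPart_nonneg a) (posPart_nonneg a))
    (mul_nonneg _ _ (negPart_nonneg a) (negPart_nonneg a))

theorem one_nonneg : (0 : G) ≤ 1 := by simpa using mul_self_nonneg (1 : G)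

/-- Completing the square, `h² - n h + n² = (h - n/2)² + 3 n²/4 ≥ 0`; the factor `4` in the proof
avoids halves. In an archimedean setting this makes `(h - n)⁺` negligible for large `n`. -/
theorem nsmul_posPart_sub_natCast_le (h : G) (n : ℕ) : n • (h - n)⁺ ≤ h * h := by
  have h1 : n • (h - n) ≤ h * h := by
    have h2 := mul_self_nonneg (2 * h - n)
    have e2 : 4 • (h * h - n • (h - n)) = (2 * h - n) * (2 * h - n) + 3 • ((n : G) * n) := by
      have := Nat.cast_commute n h
      simp only [nsmul_eq_mul, mul_sub, sub_mul]
      have h3 : h * (n : G) = n * h := (Nat.cast_commute n h).symm.eq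
      simp only [mul_assoc, h3]
      have h4 : h * (2 * h) = 2 * (h * h) := by noncomm_ring
      have h5 : (n : G) * (2 * h) = 2 * (n * h) := by
        rw [← mul_assoc, ← mul_assoc, Nat.cast_comm n (2 : G)]
      rw [h4, h5]
      push_cast
      noncomm_ring
    refine sub_nonneg.1 (lgroup_nonneg_of_nsmul_nonneg (n := 4) (by norm_num) ?_)
    rw [e2]
    exact add_nonneg h2 (nsmul_nonneg (mul_self_nonneg _) 3)
  rcases Nat.eq_zero_or_pos n with rfl | hn
  · simpa using mul_self_nonneg h
  · exact lgroup_nsmul_sup_le hn h1 (by simpa using mul_self_nonneg h)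

/-- A finite-resolution estimate of the distance to the natural numbers. -/
theorem one_add_posPart_inf_abs_le (h : G) : (1 + h⁺) ⊓ |h - 1| ≤ 1 + (h - 1)⁺ := by
  have h1 : (h - 1)⁻ ≤ 1 + h⁻ := by
    refine sup_le ?_ (add_nonneg one_nonneg (negPart_nonneg h))
    rw [neg_sub, sub_eq_add_neg]
    exact add_le_add_right (neg_le_negPart h) _
  rw [← posPart_add_negPart (h - 1)]
  set p := (h - 1)⁺
  have hp : 0 ≤ p := posPart_nonneg _
  -- Both terms are enlarged to `1 + p` plus one of the disjoint elements `h⁺` and `h⁻`.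
  calc (1 + h⁺) ⊓ (p + (h - 1)⁻) ≤ (1 + p + h⁺) ⊓ (1 + p + h⁻) := by
        refine inf_le_inf ?_ ?_
        · exact add_le_add_left (le_add_of_nonneg_right hp) _
        · rw [add_comm 1 p, add_assoc]
          exact add_le_add_right h1 _
    _ = 1 + p := by rw [← add_inf, posPart_inf_negPart_eq_zero, add_zero]

/-- The analogue for squared distances: `((h - 1)⁻)² ≤ (1 + h⁻)² = 1 + 2 h⁻ + (h⁻)²`, and `(h⁺)²` is
disjoint from both `h⁻` and `(h⁻)²`. -/
theorem one_add_sq_posPart_inf_sq_le (h : G) :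
    (1 + h⁺ * h⁺) ⊓ ((h - 1) * (h - 1)) ≤ 1 + (h - 1)⁺ * (h - 1)⁺ := by
  have h1 : (h - 1)⁻ ≤ 1 + h⁻ := by
    refine sup_le ?_ (add_nonneg one_nonneg (negPart_nonneg h))
    rw [neg_sub, sub_eq_add_neg]
    exact add_le_add_right (neg_le_negPart h) _
  have h2 : (h - 1)⁻ * (h - 1)⁻ ≤ (1 + h⁻) * (1 + h⁻) :=
    mul_le_mul ((negPart_nonneg _).trans h1) (negPart_nonneg _) h1 h1
  have e : (1 + h⁻) * (1 + h⁻) = 1 + (h⁻ + h⁻ + h⁻ * h⁻) := by noncomm_ring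
  rw [e] at h2
  rw [mul_self_eq_add (h - 1)]
  have hp : 0 ≤ (h - 1)⁺ * (h - 1)⁺ := mul_nonneg _ _ (posPart_nonneg _) (posPart_nonneg _)
  set p := (h - 1)⁺ * (h - 1)⁺
  have d0 : (h⁺ * h⁺) ⊓ h⁻ = 0 :=
    mul_right_inf_eq_zero _ _ _ (posPart_inf_negPart_eq_zero h) (posPart_nonneg h)
  have d1 : (h⁺ * h⁺) ⊓ (h⁻ * h⁻) = 0 := by
    rw [inf_comm] at d0 ⊢
    exact mul_right_inf_eq_zero _ _ _ d0 (negPart_nonneg h)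
  calc (1 + h⁺ * h⁺) ⊓ (p + (h - 1)⁻ * (h - 1)⁻)
      ≤ (1 + p + h⁺ * h⁺) ⊓ (1 + p + (h⁻ + h⁻ + h⁻ * h⁻)) := by
        refine inf_le_inf ?_ ?_
        · exact add_le_add_left (le_add_of_nonneg_right hp) _
        · rw [add_comm 1 p, add_assoc]
          exact add_le_add_right h2 _
    _ = 1 + p := by
        rw [← add_inf, inf_add_eq_zero_of_inf_eq_zero (inf_add_eq_zero_of_inf_eq_zero d0 d0) d1,
          add_zero]

/-- An archimedean unital f-ring is commutative. -/
theorem mul_comm_of_archimedean [IsArchimedeanLGroup G] (a b : G) : a * b = b * a := by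
  have nonneg_le : ∀ a b : G, 0 ≤ a → 0 ≤ b → a * b - b * a ≤ 0 := by
    intro a b ha hb
    let φ : G →+ G := AddMonoidHom.mulRight b + AddMonoidHom.mulLeft b
    have φ_apply : ∀ x, φ x = x * b + b * x := fun x => rfl
    have φ_nonneg : ∀ x, 0 ≤ x → 0 ≤ φ x := fun x hx =>
      add_nonneg (mul_nonneg _ _ hx hb) (mul_nonneg _ _ hb hx)
    have φ_mono : ∀ x y, x ≤ y → φ x ≤ φ y := fun x y h => by
      have := φ_nonneg _ (sub_nonneg.2 h)
      rwa [map_sub, sub_nonneg] at this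
    have φ_disj : ∀ x y, x ⊓ y = 0 → φ x ⊓ φ y = 0 := by
      have half : ∀ x y, x ⊓ y = 0 → x ⊓ φ y = 0 := fun x y h => by
        rw [inf_comm] at h
        refine inf_add_eq_zero_of_inf_eq_zero ?_ ?_
        · rw [inf_comm]; exact mul_right_inf_eq_zero _ _ _ h hb
        · rw [inf_comm]; exact mul_left_inf_eq_zero _ _ _ h hb
      intro x y h
      have h1 := half x y h
      rw [inf_comm] at h1 ⊢
      exact half _ _ h1
    -- The bound `φ 1 = b + b` does not depend on `n`, so it suffices to bound all multiples of the
    -- commutator by it.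
    refine lgroup_nonpos_of_forall_nsmul_le (b := φ 1) fun n => ?_
    set h := n • a with hh
    have hh0 : 0 ≤ h := nsmul_nonneg ha n
    have e : n • (a * b - b * a) = h * b - b * h := by
      rw [nsmul_sub, hh, smul_mul_assoc, mul_smul_comm]
    rw [e]
    -- Integers are central, so the commutator of `h` with `b` is also that of `h - k` with `b`.
    have dist : ∀ k : ℕ, h * b - b * h ≤ φ |h - k| := by
      intro k
      have e : h * b - b * h = (h - k) * b + b * -(h - k) := by
        have : (k : G) * b = b * k := Nat.cast_comm k b
        rw [sub_mul, mul_neg, mul_sub, this]; abel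
      rw [e]
      refine add_le_add ?_ ?_
      · exact mul_le_mul (abs_nonneg _) hb (le_abs_self _) le_rfl
      · have := mul_nonneg b _ hb (sub_nonneg.2 (neg_le_abs (h - (k : G))))
        rwa [mul_sub, sub_nonneg] at this
    -- Since `φ` preserves infima, the bounds for successive `k` combine inside `φ`.
    have grid : ∀ k : ℕ, h * b - b * h ≤ φ (1 + (h - k)⁺) := by
      intro k
      induction k with
      | zero =>
        refine (dist 0).trans (φ_mono _ _ ?_)
        rw [Nat.cast_zero, sub_zero, abs_of_nonneg hh0, posPart_of_nonneg hh0]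
        exact le_add_of_nonneg_left one_nonneg
      | succ k ih =>
        refine (le_inf ih (dist (k + 1))).trans ?_
        rw [← map_inf_of_map_inf_eq_zero φ φ_disj]
        have := one_add_posPart_inf_abs_le (h - (k : G))
        rw [sub_sub] at this
        rw [Nat.cast_succ]
        exact φ_mono _ _ this
    -- Here `h` is fixed and `k` varies: `k • φ (h - k)⁺ ≤ φ (h * h)` eliminates the excess over `φ
    -- 1`.
    refine sub_nonpos.1 (lgroup_nonpos_of_forall_nsmul_le (b := φ (h * h)) fun k => ?_)
    refine le_trans ?_ (φ_mono _ _ (nsmul_posPart_sub_natCast_le h k))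
    rw [map_nsmul]
    refine nsmul_le_nsmul_right ?_ k
    rw [sub_le_iff_le_add', ← map_add]
    exact grid k
  have nonneg_eq : ∀ a b : G, 0 ≤ a → 0 ≤ b → a * b = b * a := fun a b ha hb =>
    le_antisymm (sub_nonpos.1 (nonneg_le a b ha hb)) (sub_nonpos.1 (nonneg_le b a hb ha))
  rw [← posPart_sub_negPart a, ← posPart_sub_negPart b]
  simp only [sub_mul, mul_sub, nonneg_eq _ _ (posPart_nonneg a) (posPart_nonneg b),
    nonneg_eq _ _ (posPart_nonneg a) (negPart_nonneg b),
    nonneg_eq _ _ (negPart_nonneg a) (posPart_nonneg b),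
    nonneg_eq _ _ (negPart_nonneg a) (negPart_nonneg b)]
  abel

end IsFRing
theorem zsmul_sub_zsmul_one_mul_self {R : Type*} [Ring R] (a b : ℤ) (g : R) :
    (a • g - b • (1 : R)) * (a • g - b • (1 : R))
      = (a ^ 2) • (g * g) - (2 * a * b) • g + (b ^ 2) • (1 : R) := by
  simp only [sub_mul, mul_sub, smul_mul_smul_comm, mul_one, one_mul]
  module

/-! ### Squares with respect to a positive element of a vector lattice -/

section Square

variable {C : Type*} [AddCommGroup C] [Lattice C] [Module ℝ C]

/-- `IsSupTangents e x s` says that `s` is the supremum of the "tangents" `2 r x - r² e`, for `r`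
rational. In an archimedean f-algebra with unit `e`, this means that `s` is the square of `x`. -/
def IsSupTangents (e x s : C) : Prop :=
  IsLUB (Set.range fun r : ℚ => (2 * r : ℝ) • x - (r ^ 2 : ℝ) • e) s

namespace IsSupTangents

variable {e x y s t u v : C}

theorem le (h : IsSupTangents e x s) (r : ℚ) : (2 * r : ℝ) • x - (r ^ 2 : ℝ) • e ≤ s :=
  h.1 ⟨r, rfl⟩

theorem le_of_forall (h : IsSupTangents e x s)
    (ht : ∀ r : ℚ, (2 * r : ℝ) • x - (r ^ 2 : ℝ) • e ≤ t) : s ≤ t :=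
  h.2 (by rintro _ ⟨r, rfl⟩; exact ht r)

theorem neg (h : IsSupTangents e x s) : IsSupTangents e (-x) s := by
  refine ⟨?_, fun t ht => h.le_of_forall fun r => ?_⟩
  · rintro _ ⟨r, rfl⟩
    convert h.le (-r) using 1
    push_cast
    module
  · convert ht ⟨-r, rfl⟩ using 1
    push_cast
    module

theorem nonneg (h : IsSupTangents e x s) : 0 ≤ s := by simpa using h.le 0

section

variable [IsOrderedAddMonoid C]

theorem add_smul_unit (h : IsSupTangents e x s) (c : ℚ) :
    IsSupTangents e (x + (c : ℝ) • e) (s + (2 * c : ℝ) • x + (c ^ 2 : ℝ) • e) := by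
  refine ⟨?_, fun t ht => ?_⟩
  · rintro _ ⟨r, rfl⟩
    convert add_le_add_left (h.le (r - c)) ((2 * c : ℝ) • x + (c ^ 2 : ℝ) • e) using 1
    · push_cast
      module
    · abel
  · rw [add_assoc, ← le_sub_iff_add_le]
    refine h.le_of_forall fun r => ?_
    rw [le_sub_iff_add_le]
    convert ht ⟨r + c, rfl⟩ using 1
    push_cast
    module

end

section

variable [IsOrderedModule ℝ C]

theorem smul_two (h : IsSupTangents e x s) : IsSupTangents e ((2 : ℝ) • x) ((4 : ℝ) • s) := by
  refine ⟨?_, fun t ht => ?_⟩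
  · rintro _ ⟨r, rfl⟩
    have := smul_le_smul_of_nonneg_left (h.le (r / 2)) (by norm_num : (0 : ℝ) ≤ 4)
    convert this using 1
    push_cast
    module
  · have h1 : s ≤ (4⁻¹ : ℝ) • t := h.le_of_forall fun r => by
      have := smul_le_smul_of_nonneg_left (ht ⟨2 * r, rfl⟩) (by norm_num : (0 : ℝ) ≤ 4⁻¹)
      convert this using 1
      push_cast
      module
    have := smul_le_smul_of_nonneg_left h1 (by norm_num : (0 : ℝ) ≤ 4)
    rwa [smul_smul, mul_inv_cancel₀ (by norm_num), one_smul] at this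

end

variable [IsOrderedAddMonoid C] [IsOrderedModule ℝ C]

/-- A tangent of parameter `r` for `x + y` plus one of parameter `r'` for `x - y` equals twice the
tangent of parameter `(r + r')/2` for `x` plus twice that of parameter `(r - r')/2` for `y`. -/
theorem add_le (hs : IsSupTangents e (x + y) s) (ht : IsSupTangents e (x - y) t)
    (hu : IsSupTangents e x u) (hv : IsSupTangents e y v) :
    s + t ≤ (2 : ℝ) • u + (2 : ℝ) • v := by
  rw [← le_sub_iff_add_le]
  refine hs.le_of_forall fun r => ?_
  rw [le_sub_comm]
  refine ht.le_of_forall fun r' => ?_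
  rw [le_sub_iff_add_le]
  have h1 := smul_le_smul_of_nonneg_left (hu.le ((r + r') / 2)) (by norm_num : (0 : ℝ) ≤ 2)
  have h2 := smul_le_smul_of_nonneg_left (hv.le ((r - r') / 2)) (by norm_num : (0 : ℝ) ≤ 2)
  convert add_le_add h1 h2 using 1
  push_cast
  module

/-- The parallelogram law. -/
theorem add_eq (hs : IsSupTangents e (x + y) s) (ht : IsSupTangents e (x - y) t)
    (hu : IsSupTangents e x u) (hv : IsSupTangents e y v) :
    s + t = (2 : ℝ) • u + (2 : ℝ) • v := by
  refine le_antisymm (add_le hs ht hu hv) ?_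
  -- The reverse inequality is the same one for the pair `x + y`, `x - y`, whose sum and difference
  -- are `2 x` and `2 y`.
  have e1 : x + y + (x - y) = (2 : ℝ) • x := by module
  have e2 : x + y - (x - y) = (2 : ℝ) • y := by module
  have h := add_le (e1.symm ▸ hu.smul_two) (e2.symm ▸ hv.smul_two) hs ht
  have := smul_le_smul_of_nonneg_left h (by norm_num : (0 : ℝ) ≤ 2⁻¹)
  convert this using 1 <;> module

/-- The tangent of parameter `r` for `x` lies below that of parameter `|r|` for `y`. -/
theorem mono (hs : IsSupTangents e x s) (ht : IsSupTangents e y t) (hxy : x ≤ y) (hxy' : -x ≤ y) :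
    s ≤ t := by
  refine hs.le_of_forall fun r => ?_
  rcases le_total 0 r with hr | hr
  · refine le_trans (sub_le_sub_right ?_ _) (ht.le r)
    exact smul_le_smul_of_nonneg_left hxy (by positivity)
  · have h1 := ht.le (-r)
    have h2 : (2 * r : ℝ) • x ≤ (2 * (-r : ℚ) : ℝ) • y := by
      have h3 : (0 : ℝ) ≤ 2 * (-r : ℚ) := by
        have : (0 : ℚ) ≤ -r := neg_nonneg.2 hr
        positivity
      convert smul_le_smul_of_nonneg_left hxy' h3 using 1
      push_cast
      module
    refine le_trans ?_ h1
    push_cast at h2 ⊢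
    rw [neg_sq]
    exact sub_le_sub_right h2 _

/-- An element is bounded by a large multiple of `e` and a small multiple of its square. -/
theorem le_smul_add_smul (h : IsSupTangents e x s) (n : ℕ) (hn : 0 < n) (he : 0 ≤ e) :
    x ≤ (n : ℝ) • e + (n : ℝ)⁻¹ • s := by
  have hn' : (0 : ℝ) < n := by exact_mod_cast hn
  -- Parameter `n / 2` gives coefficient `1` for `x` after division by `n`; the resulting `n / 4` is
  -- then relaxed to `n`.
  have h1 := smul_le_smul_of_nonneg_left (h.le (n / 2)) (inv_pos.2 hn').le
  have e1 : ((n : ℝ)⁻¹) • ((2 * ((n / 2 : ℚ) : ℝ)) • x - (((n / 2 : ℚ) : ℝ) ^ 2) • e)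
      = x - (n / 4 : ℝ) • e := by
    rw [smul_sub, smul_smul, smul_smul]
    push_cast
    have a1 : (n : ℝ)⁻¹ * (2 * (n / 2)) = 1 := by field_simp
    have a2 : (n : ℝ)⁻¹ * (n / 2) ^ 2 = n / 4 := by field_simp; norm_num
    rw [a1, a2, one_smul]
  rw [e1, sub_le_iff_le_add'] at h1
  refine h1.trans (add_le_add_left (smul_le_smul_of_nonneg_right ?_ he) _)
  linarith

end IsSupTangents

/-! ### Polarization of the square map -/

variable [IsOrderedAddMonoid C] [IsOrderedModule ℝ C]

/-- Additivity handles the integer part of `n r`; positivity bounds the contribution of the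
fractional part by `f x` when `x ≥ 0`, uniformly in `n`. The reverse inequality comes from `-r`. -/
theorem map_smul_of_nonneg (harch : ∀ a b : C, (∀ n : ℕ, n • a ≤ b) → a ≤ 0) (f : C →+ C)
    (hf : ∀ x, 0 ≤ x → 0 ≤ f x) (r : ℝ) (x : C) : f (r • x) = r • f x := by
  have le : ∀ x : C, 0 ≤ x → ∀ r : ℝ, f (r • x) ≤ r • f x := by
    intro x hx r
    refine sub_nonpos.1 (harch _ (f x) fun n => ?_)
    have h0 := Int.floor_le (n * r)
    have h1 := (Int.lt_floor_add_one (n * r)).le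
    have e : n • (f (r • x) - r • f x)
        = f (((n * r : ℝ) - ⌊n * r⌋) • x) - ((n * r : ℝ) - ⌊n * r⌋) • f x := by
      rw [nsmul_sub, ← map_nsmul, sub_smul, map_sub, Int.cast_smul_eq_zsmul, map_zsmul,
        ← Int.cast_smul_eq_zsmul ℝ, ← Nat.cast_smul_eq_nsmul ℝ, ← Nat.cast_smul_eq_nsmul ℝ,
        smul_smul, smul_smul]
      module
    rw [e]
    have h2 : f (((n * r : ℝ) - ⌊n * r⌋) • x) ≤ f x := by
      rw [← sub_nonneg, ← map_sub]
      refine hf _ (sub_nonneg.2 ?_)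
      conv_rhs => rw [← one_smul ℝ x]
      exact smul_le_smul_of_nonneg_right (by linarith) hx
    exact (sub_le_self _ (smul_nonneg (by linarith) (hf x hx))).trans h2
  have eq : ∀ x : C, 0 ≤ x → f (r • x) = r • f x := fun x hx => by
    refine le_antisymm (le x hx r) ?_
    have := le x hx (-r)
    rwa [neg_smul, neg_smul, map_neg, neg_le_neg_iff] at this
  rw [← posPart_sub_negPart x, smul_sub, map_sub, map_sub, smul_sub, eq _ (posPart_nonneg x),
    eq _ (negPart_nonneg x)]

variable {e : C} {q : C → C}

/-- The Jordan–von Neumann argument. With `D x = q (x + y) - q (x - y)`, the parallelogram law gives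
`D (x + x') + D (x - x') = 2 D x`. Taking `x' = x` gives `D (2 x) = 2 D x`, and half-sums and
half-differences then give additivity. -/
theorem isSupTangents_polar_add_left (hq : ∀ x, IsSupTangents e x (q x)) (x x' y : C) :
    q (x + x' + y) - q (x + x' - y) = (q (x + y) - q (x - y)) + (q (x' + y) - q (x' - y)) := by
  have par : ∀ x y, q (x + y) + q (x - y) = (2 : ℝ) • q x + (2 : ℝ) • q y :=
    fun x y => IsSupTangents.add_eq (hq _) (hq _) (hq _) (hq _)
  have q_neg : ∀ x, q (-x) = q x := fun x => (hq _).unique (hq x).neg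
  have mid : ∀ x x' y, (q (x + x' + y) - q (x + x' - y)) + (q (x - x' + y) - q (x - x' - y))
      = (2 : ℝ) • (q (x + y) - q (x - y)) := by
    intro x x' y
    have h1 := par (x + y) x'
    have h2 := par (x - y) x'
    rw [show x + y + x' = x + x' + y by abel, show x + y - x' = x - x' + y by abel] at h1
    rw [show x - y + x' = x + x' - y by abel, show x - y - x' = x - x' - y by abel] at h2
    have e1 : (2 : ℝ) • (q (x + y) - q (x - y))
        = ((2 : ℝ) • q (x + y) + (2 : ℝ) • q x') - ((2 : ℝ) • q (x - y) + (2 : ℝ) • q x') := by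
      module
    rw [e1, ← h1, ← h2]
    abel
  have dbl : ∀ x y, q (x + x + y) - q (x + x - y) = (2 : ℝ) • (q (x + y) - q (x - y)) := by
    intro x y
    have h := mid x x y
    rwa [sub_self, zero_add, zero_sub, q_neg, sub_self, add_zero] at h
  have h1 := mid ((2⁻¹ : ℝ) • (x + x')) ((2⁻¹ : ℝ) • (x - x')) y
  rw [← dbl, show (2⁻¹ : ℝ) • (x + x') + (2⁻¹ : ℝ) • (x - x') = x by module,
    show (2⁻¹ : ℝ) • (x + x') - (2⁻¹ : ℝ) • (x - x') = x' by module,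
    show (2⁻¹ : ℝ) • (x + x') + (2⁻¹ : ℝ) • (x + x') = x + x' by module] at h1
  exact h1.symm

/-- Polarization: squares come from a positive symmetric bilinear multiplication. -/
theorem exists_mul_of_isSupTangents (harch : ∀ a b : C, (∀ n : ℕ, n • a ≤ b) → a ≤ 0)
    (hq : ∀ x, IsSupTangents e x (q x)) :
    ∃ m : C →ₗ[ℝ] C →ₗ[ℝ] C, (∀ x y, m x y = m y x) ∧ (∀ x y, 0 ≤ x → 0 ≤ y → 0 ≤ m x y) ∧
      (∀ x, m x x = q x) ∧ ∀ x, m e x = x := by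
  set B : C → C → C := fun x y => (4⁻¹ : ℝ) • (q (x + y) - q (x - y)) with hB
  have q_neg : ∀ x, q (-x) = q x := fun x => (hq _).unique (hq x).neg
  have symm : ∀ x y, B x y = B y x := fun x y => by
    simp only [hB]
    rw [add_comm x y, ← neg_sub x y, q_neg]
  have add_left : ∀ x x' y, B (x + x') y = B x y + B x' y := fun x x' y => by
    simp only [hB]
    rw [isSupTangents_polar_add_left hq, smul_add]
  have add_right : ∀ y x x', B y (x + x') = B y x + B y x' := fun y x x' => by
    rw [symm, add_left, symm x, symm x']
  have nonneg : ∀ x y, 0 ≤ x → 0 ≤ y → 0 ≤ B x y := by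
    intro x y hx hy
    refine smul_nonneg (by norm_num) (sub_nonneg.2 ?_)
    -- For positive `x` and `y` one has `|x - y| ≤ x + y`, so the squares compare.
    refine (hq _).mono (hq _) ((sub_le_self _ hy).trans (le_add_of_nonneg_right hy)) ?_
    rw [neg_sub]
    exact (sub_le_self _ hx).trans (le_add_of_nonneg_left hx)
  have smul_pos : ∀ y, 0 ≤ y → ∀ (r : ℝ) x, B (r • x) y = r • B x y := fun y hy r x =>
    map_smul_of_nonneg harch (AddMonoidHom.mk' (fun x => B x y) fun x x' => add_left x x' y)
      (fun x hx => nonneg x y hx hy) r x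
  have sub_right : ∀ y x x', B y (x - x') = B y x - B y x' := fun y x x' => by
    rw [eq_sub_iff_add_eq, ← add_right, sub_add_cancel]
  have smul_left : ∀ (r : ℝ) x y, B (r • x) y = r • B x y := fun r x y => by
    rw [← posPart_sub_negPart y, sub_right, sub_right, smul_pos _ (posPart_nonneg y),
      smul_pos _ (negPart_nonneg y), smul_sub]
  have smul_right : ∀ (r : ℝ) x y, B x (r • y) = r • B x y := fun r x y => by
    rw [symm, smul_left, symm]
  have q_add : ∀ (x : C) (c : ℚ), q (x + (c : ℝ) • e) = q x + (2 * c : ℝ) • x + (c ^ 2 : ℝ) • e :=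
    fun x c => (hq _).unique ((hq x).add_smul_unit c)
  refine ⟨LinearMap.mk₂ ℝ B add_left smul_left add_right smul_right, symm, nonneg, ?_, ?_⟩
  · intro x
    have q0 : q 0 = 0 := by
      have := IsSupTangents.add_eq (hq (0 + 0)) (hq (0 - 0)) (hq 0) (hq 0)
      rw [add_zero, sub_zero, ← two_smul ℝ, ← smul_add, ← two_smul ℝ (q 0)] at this
      have h2 : (2 : ℝ) • q 0 = 0 := by
        have h3 := smul_right_injective C (two_ne_zero (α := ℝ)) this
        rw [two_smul] at h3 ⊢
        rw [left_eq_add.1 h3, add_zero]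
      simpa using h2
    have q2 : q (x + x) = (4 : ℝ) • q x := by
      rw [← two_smul ℝ x]
      exact (hq _).unique (hq x).smul_two
    change (4⁻¹ : ℝ) • (q (x + x) - q (x - x)) = q x
    rw [q2, sub_self, q0]
    module
  · intro x
    change B e x = x
    -- The values `q (x ± e) = q x ± 2 x + e` differ by `4 x`.
    have h1 := q_add x 1
    have h2 := q_add x (-1)
    rw [symm]
    simp only [hB]
    push_cast at h1 h2
    rw [one_smul] at h1
    rw [neg_one_smul, ← sub_eq_add_neg] at h2
    rw [h1, h2]
    module

/-- A positive multiplication with unit `e` on an archimedean vector lattice preserves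
disjointness, if the squares are as they should be. -/
theorem mul_inf_eq_zero_of_isSupTangents (harch : ∀ a b : C, (∀ n : ℕ, n • a ≤ b) → a ≤ 0)
    (he : 0 ≤ e) (hq : ∀ x, IsSupTangents e x (q x)) (m : C →ₗ[ℝ] C →ₗ[ℝ] C)
    (hm : ∀ x y, 0 ≤ x → 0 ≤ y → 0 ≤ m x y) (hme : ∀ x, m e x = x) {a b c : C}
    (hab : a ⊓ b = 0) (hc : 0 ≤ c) : m c a ⊓ b = 0 := by
  have ha : 0 ≤ a := hab ▸ inf_le_left
  have hb : 0 ≤ b := hab ▸ inf_le_right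
  refine le_antisymm (harch _ (m (q c) a) fun n => ?_) (le_inf (hm c a hc ha) hb)
  have hw : 0 ≤ m (q c) a := hm _ _ (hq c).nonneg ha
  rcases Nat.eq_zero_or_pos n with rfl | hn
  · simpa using hw
  have hn' : (0 : ℝ) < n := by exact_mod_cast hn
  have h1 : m c a ≤ n • a + (n : ℝ)⁻¹ • m (q c) a := by
    have := hm _ a (sub_nonneg.2 ((hq c).le_smul_add_smul n hn he)) ha
    rw [map_sub, map_add, map_smul, map_smul, LinearMap.sub_apply, LinearMap.add_apply,
      LinearMap.smul_apply, LinearMap.smul_apply, hme, sub_nonneg,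
      Nat.cast_smul_eq_nsmul] at this
    exact this
  -- The right side vanishes by disjointness, leaving `n • (m c a ⊓ b) ≤ m (q c) a` for every `n`.
  have h2 : m c a ⊓ b - (n : ℝ)⁻¹ • m (q c) a ≤ (n • a) ⊓ b := le_inf
    (sub_le_iff_le_add.2 (inf_le_left.trans h1))
    ((sub_le_self _ (smul_nonneg (inv_pos.2 hn').le hw)).trans inf_le_right)
  rw [nsmul_inf_eq_zero hab, sub_nonpos] at h2
  have h3 := smul_le_smul_of_nonneg_left h2 hn'.le
  rwa [smul_smul, mul_inv_cancel₀ hn'.ne', one_smul, Nat.cast_smul_eq_nsmul] at h3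

/-! ### Squares of the f-ring as suprema of tangents -/

variable {G : Type*} [Ring G] [Lattice G] [IsOrderedAddMonoid G] [IsFRing G]

/-- In the image of a unital f-ring in an archimedean vector lattice, squares are suprema of
tangents. -/
theorem isSupTangents_mul_self (harch : ∀ a b : C, (∀ n : ℕ, n • a ≤ b) → a ≤ 0) (ι : G →+ C)
    (hι : ∀ a b, a ≤ b → ι a ≤ ι b) (hinf : ∀ a b, ι (a ⊓ b) = ι a ⊓ ι b) {g : G} (hg : 0 ≤ g) :
    IsSupTangents (ι 1) (ι g) (ι (g * g)) := by
  constructor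
  · rintro _ ⟨r, rfl⟩
    -- Clearing the denominator of `r` keeps the square inside `G`.
    have h1 := hι _ _ (IsFRing.mul_self_nonneg ((r.den : ℤ) • g - r.num • (1 : G)))
    have hd : (0 : ℝ) < r.den := by exact_mod_cast r.pos
    have hr : (r : ℝ) = r.num / r.den := Rat.cast_def r
    rw [zsmul_sub_zsmul_one_mul_self, map_zero] at h1
    simp only [map_add, map_sub, map_zsmul, ← Int.cast_smul_eq_zsmul ℝ] at h1
    have h2 := smul_nonneg (by positivity : 0 ≤ ((r.den : ℝ)⁻¹) ^ 2) h1
    rw [← sub_nonneg]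
    convert h2 using 1
    beta_reduce
    rw [hr]
    push_cast
    match_scalars <;> field_simp
  · intro z hz
    refine sub_nonpos.1 (harch _ (ι 1) fun n => ?_)
    have h1' : 0 ≤ ι 1 := by simpa using hι _ _ (IsFRing.one_nonneg (G := G))
    rcases Nat.eq_zero_or_pos n with rfl | hn
    · simpa using h1'
    have hn' : (0 : ℝ) < n := by exact_mod_cast hn
    set h := n • g with hh
    have hh0 : 0 ≤ h := nsmul_nonneg hg n
    -- The tangent of parameter `k / n`, scaled by `n²`, bounds this defect by `(n g - k)²`. The
    -- grid device will give `t ≤ ι 1`, and division by `n` then bounds `n • (ι (g * g) - z)`.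
    set t : C := (n ^ 2 : ℝ) • (ι (g * g) - z) with ht
    have dist : ∀ k : ℕ, t ≤ ι ((h - k) * (h - k)) := by
      intro k
      have h1 := smul_le_smul_of_nonneg_left (hz ⟨k / n, rfl⟩) (sq_nonneg (n : ℝ))
      have e1 : h - (k : G) = (n : ℤ) • g - (k : ℤ) • (1 : G) := by simp [hh]
      rw [e1, zsmul_sub_zsmul_one_mul_self]
      simp only [map_add, map_sub, map_zsmul, ← Int.cast_smul_eq_zsmul ℝ]
      rw [← sub_nonneg] at h1 ⊢
      convert h1 using 1
      rw [ht]
      push_cast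
      match_scalars <;> field_simp
      ring
    have grid : ∀ k : ℕ, t ≤ ι (1 + (h - k)⁺ * (h - k)⁺) := by
      intro k
      induction k with
      | zero =>
        refine (dist 0).trans (hι _ _ ?_)
        rw [Nat.cast_zero, sub_zero, posPart_of_nonneg hh0]
        exact le_add_of_nonneg_left IsFRing.one_nonneg
      | succ k ih =>
        refine (le_inf ih (dist (k + 1))).trans ?_
        rw [← hinf]
        have := IsFRing.one_add_sq_posPart_inf_sq_le (h - (k : G))
        rw [sub_sub] at this
        rw [Nat.cast_succ]
        exact hι _ _ this
    have ht1 : t ≤ ι 1 := by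
      -- Squaring `k (h - k)⁺ ≤ h²` gives `k² ((h - k)⁺)² ≤ h⁴`, and `k ≤ k²`.
      refine sub_nonpos.1 (harch _ (ι (h * h * (h * h))) fun k => ?_)
      rcases Nat.eq_zero_or_pos k with rfl | hk
      · rw [zero_smul, ← map_zero ι]
        exact hι _ _ (IsFRing.mul_self_nonneg _)
      have h2 := IsFRing.nsmul_posPart_sub_natCast_le h k
      have hp : 0 ≤ (h - k)⁺ := posPart_nonneg _
      have h3 := IsFRing.mul_le_mul (IsFRing.mul_self_nonneg h) (nsmul_nonneg hp k) h2 h2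
      rw [smul_mul_smul_comm] at h3
      have h4 := (nsmul_le_nsmul_left (IsFRing.mul_nonneg _ _ hp hp)
        (Nat.le_mul_of_pos_left k hk)).trans h3
      refine le_trans ?_ (hι _ _ h4)
      rw [map_nsmul]
      refine nsmul_le_nsmul_right ?_ k
      rw [sub_le_iff_le_add', ← map_add]
      exact grid k
    have h5 := smul_le_smul_of_nonneg_left ht1 (inv_pos.2 hn').le
    have e5 : (n : ℝ)⁻¹ • t = n • (ι (g * g) - z) := by
      rw [ht, ← Nat.cast_smul_eq_nsmul ℝ, smul_smul]
      congr 1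
      field_simp
    rw [e5] at h5
    refine h5.trans ?_
    conv_rhs => rw [← one_smul ℝ (ι 1)]
    refine smul_le_smul_of_nonneg_right ?_ h1'
    exact inv_le_one_of_one_le₀ (by exact_mod_cast hn)

end Square
/-! ### Multiplications on the vector lattice cover -/

namespace IsFAlgebraMul

variable {V : Type*} [AddCommGroup V] [Lattice V] [IsOrderedAddMonoid V]
    [Module ℝ V] [IsOrderedModule ℝ V] {m : V →ₗ[ℝ] V →ₗ[ℝ] V}

theorem map_sup_right (h : IsFAlgebraMul m) {c : V} (hc : 0 ≤ c) (x y : V) :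
    m c (x ⊔ y) = m c x ⊔ m c y :=
  map_sup_of_inf_eq_zero (m c).toAddMonoidHom
    (fun a b hab => h.mul_left_inf_eq_zero a b c hab hc) x y

theorem map_sup_left (h : IsFAlgebraMul m) {c : V} (hc : 0 ≤ c) (x y : V) :
    m (x ⊔ y) c = m x c ⊔ m y c :=
  map_sup_of_inf_eq_zero (m.flip c).toAddMonoidHom
    (fun a b hab => h.mul_right_inf_eq_zero a b c hab hc) x y

end IsFAlgebraMul

/-! ### Arguments from generators of the cover -/

section CoverInduction

variable {G : Type*} [AddCommGroup G] [Lattice G] [IsOrderedAddMonoid G] [IsArchimedeanLGroup G]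

theorem coverSubspace_le {W : Submodule ℝ (DMCompletion (DivHull G))}
    (hW : ∀ g, completionOf G g ∈ W) (hsup : ∀ x ∈ W, ∀ y ∈ W, x ⊔ y ∈ W) :
    coverSubspace G ≤ W := by
  refine sInf_le ⟨hW, fun x hx y hy => hsup x hx y hy, fun x hx y hy => ?_⟩
  have := W.neg_mem (hsup _ (W.neg_mem hx) _ (W.neg_mem hy))
  rwa [neg_sup, neg_neg, neg_neg] at this

theorem completionOf_mem_coverSubspace (g : G) : completionOf G g ∈ coverSubspace G :=
  (VectorLatticeCover.of g).2

theorem exists_abs_le_completionOf (x : DMCompletion (DivHull G)) :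
    ∃ g : G, 0 ≤ g ∧ |x| ≤ completionOf G g := by
  obtain ⟨u, hu⟩ := (|x|).U_nonempty
  obtain ⟨g, hg, hug⟩ := DivHull.exists_le_of u
  exact ⟨g, hg, (DMCompletion.le_of_iff.2 hu).trans (DMCompletion.of_le_of.2 hug)⟩

theorem completionOf_le_completionOf {a b : G} :
    completionOf G a ≤ completionOf G b ↔ a ≤ b :=
  DMCompletion.of_le_of.trans DivHull.of_le_of

theorem completionOf_inf (a b : G) :
    completionOf G (a ⊓ b) = completionOf G a ⊓ completionOf G b :=
  congrArg Subtype.val (VectorLatticeCover.of_inf a b)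

theorem DMCompletion.archimedean (a b : DMCompletion (DivHull G)) (h : ∀ n : ℕ, n • a ≤ b) :
    a ≤ 0 :=
  nonpos_of_forall_nsmul_le_of_complete DMCompletion.exists_isLUB h

namespace VectorLatticeCover

theorem of_nonneg {a : G} : 0 ≤ a → 0 ≤ of a := fun h => by
  rw [← map_zero of]
  exact of_le_of.2 h

/-- Two linear lattice homomorphisms of `R[G]` which agree on `G` are equal. -/
theorem linearMap_ext {S T : VectorLatticeCover G →ₗ[ℝ] VectorLatticeCover G}
    (hS : ∀ x y, S (x ⊔ y) = S x ⊔ S y) (hT : ∀ x y, T (x ⊔ y) = T x ⊔ T y)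
    (h : ∀ g : G, 0 ≤ g → S (of g) = T (of g)) : S = T := by
  have h' : ∀ g : G, S (of g) = T (of g) := fun g => by
    rw [← posPart_sub_negPart g, map_sub, map_sub, map_sub, h _ (posPart_nonneg g),
      h _ (negPart_nonneg g)]
  -- The image in the completion of the equalizer of `S` and `T` is a vector sublattice containing
  -- `G`.
  have key := coverSubspace_le (G := G)
    (W := (LinearMap.eqLocus S T).map (coverSubspace G).subtype)
    (fun g => ⟨of g, h' g, rfl⟩) (by
      rintro _ ⟨x, hx, rfl⟩ _ ⟨y, hy, rfl⟩
      refine ⟨x ⊔ y, ?_, rfl⟩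
      change S x = T x at hx
      change S y = T y at hy
      change S (x ⊔ y) = T (x ⊔ y)
      rw [hS, hT, hx, hy])
  refine LinearMap.ext fun x => ?_
  obtain ⟨y, hy, hyx⟩ := key x.2
  obtain rfl : y = x := Subtype.ext hyx
  exact hy

end VectorLatticeCover

end CoverInduction

/-! ### The product on the completion and its restriction to the cover -/

section CoverMul

variable {G : Type*} [Ring G] [Lattice G] [IsOrderedAddMonoid G] [IsArchimedeanLGroup G]

/-- The vector lattice cover is closed under a multiplication of the completion that extends
the multiplication of `G`. -/
theorem mul_mem_coverSubspace
    {m : DMCompletion (DivHull G) →ₗ[ℝ] DMCompletion (DivHull G) →ₗ[ℝ] DMCompletion (DivHull G)}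
    (symm : ∀ x y, m x y = m y x)
    (disj : ∀ a b c, a ⊓ b = 0 → 0 ≤ c → m c a ⊓ b = 0)
    (hm : ∀ a b : G, m (completionOf G a) (completionOf G b) = completionOf G (a * b))
    {x y : DMCompletion (DivHull G)} (hx : x ∈ coverSubspace G) (hy : y ∈ coverSubspace G) :
    m x y ∈ coverSubspace G := by
  have map_sup : ∀ c, 0 ≤ c → ∀ x y, m c (x ⊔ y) = m c x ⊔ m c y := fun c hc x y =>
    map_sup_of_inf_eq_zero (m c).toAddMonoidHom (fun a b hab => disj a b c hab hc) x y
  have step : ∀ c, 0 ≤ c → (∀ a : G, m c (completionOf G a) ∈ coverSubspace G) →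
      ∀ x ∈ coverSubspace G, m c x ∈ coverSubspace G := by
    intro c hc h x hx
    refine coverSubspace_le (W := (coverSubspace G).comap (m c)) h (fun x hx y hy => ?_) hx
    rw [Submodule.mem_comap, map_sup c hc]
    exact supClosed_coverSubspace G hx hy
  have of_mul : ∀ a : G, ∀ x ∈ coverSubspace G, m (completionOf G a) x ∈ coverSubspace G := by
    have pos : ∀ a : G, 0 ≤ a → ∀ x ∈ coverSubspace G,
        m (completionOf G a) x ∈ coverSubspace G := fun a ha => by
      refine step _ ?_ fun b => ?_
      · rw [← map_zero (completionOf G)]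
        exact completionOf_le_completionOf.2 ha
      · rw [hm]
        exact completionOf_mem_coverSubspace _
    intro a x hx
    rw [← posPart_sub_negPart a, map_sub, map_sub, LinearMap.sub_apply]
    exact sub_mem (pos _ (posPart_nonneg a) x hx) (pos _ (negPart_nonneg a) x hx)
  -- Symmetry lets the case of a factor in `G` serve as the input on generators.
  have pos : ∀ x ∈ coverSubspace G, 0 ≤ x → ∀ y ∈ coverSubspace G, m x y ∈ coverSubspace G :=
    fun x hx hx0 => step x hx0 fun a => by
      rw [symm]
      exact of_mul a x hx
  rw [← posPart_sub_negPart x, map_sub, LinearMap.sub_apply]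
  exact sub_mem
    (pos _ (supClosed_coverSubspace G hx (zero_mem _)) (posPart_nonneg x) y hy)
    (pos _ (supClosed_coverSubspace G (neg_mem hx) (zero_mem _)) (negPart_nonneg x) y hy)

variable [IsFRing G]

/-- Only an upper bound for the tangents is needed. If `|x| ≤ g` with `g` in `G`, then `2 r x - r² e
≤ 2 |r| g - r² e ≤ g²`. -/
theorem exists_isSupTangents_completion (x : DMCompletion (DivHull G)) :
    ∃ s, IsSupTangents (completionOf G 1) x s := by
  obtain ⟨g, hg, hxg⟩ := exists_abs_le_completionOf x
  have hgs := isSupTangents_mul_self DMCompletion.archimedean (completionOf G)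
    (fun a b => completionOf_le_completionOf.2) completionOf_inf hg
  refine DMCompletion.exists_isLUB _ ⟨_, 0, rfl⟩ ⟨completionOf G (g * g), ?_⟩
  rintro _ ⟨r, rfl⟩
  have hr : (2 * r : ℝ) • x ≤ (2 * (|r| : ℚ) : ℝ) • completionOf G g := by
    have h1 := smul_le_smul_of_nonneg_left hxg (by positivity : (0 : ℝ) ≤ 2 * |(r : ℝ)|)
    rw [Rat.cast_abs]
    refine le_trans ?_ h1
    rcases le_total 0 (r : ℝ) with h | h
    · rw [abs_of_nonneg h]
      exact smul_le_smul_of_nonneg_left (le_abs_self x) (by positivity)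
    · rw [abs_of_nonpos h, mul_neg, neg_smul, ← smul_neg, ← sub_nonneg]
      have h2 := smul_nonneg (by linarith : (0 : ℝ) ≤ -(2 * r))
        (sub_nonneg.2 (neg_le_abs x))
      convert h2 using 1
      module
  have h3 := hgs.le |r|
  rw [show ((|r| : ℚ) : ℝ) ^ 2 = (r : ℝ) ^ 2 by rw [Rat.cast_abs, sq_abs]] at h3
  exact (sub_le_sub_right hr _).trans h3

/-- The multiplication of an archimedean unital f-ring extends to the Dedekind completion of
its divisible hull. -/
theorem exists_mul_completion :
    ∃ m : DMCompletion (DivHull G) →ₗ[ℝ] DMCompletion (DivHull G) →ₗ[ℝ] DMCompletion (DivHull G),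
      (∀ x y, m x y = m y x) ∧ (∀ x y, 0 ≤ x → 0 ≤ y → 0 ≤ m x y) ∧
      (∀ a b c, a ⊓ b = 0 → 0 ≤ c → m c a ⊓ b = 0) ∧
      ∀ a b : G, m (completionOf G a) (completionOf G b) = completionOf G (a * b) := by
  choose q hq using exists_isSupTangents_completion (G := G)
  have he : 0 ≤ completionOf G 1 := by
    rw [← map_zero (completionOf G)]
    exact completionOf_le_completionOf.2 IsFRing.one_nonneg
  obtain ⟨m, symm, nonneg, hmq, hme⟩ := exists_mul_of_isSupTangents DMCompletion.archimedean hq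
  refine ⟨m, symm, nonneg, fun a b c hab hc =>
    mul_inf_eq_zero_of_isSupTangents DMCompletion.archimedean he hq m nonneg hme hab hc, ?_⟩
  have sq : ∀ g : G, 0 ≤ g →
      m (completionOf G g) (completionOf G g) = completionOf G (g * g) := fun g hg => by
    rw [hmq]
    exact (hq _).unique (isSupTangents_mul_self DMCompletion.archimedean (completionOf G)
      (fun a b => completionOf_le_completionOf.2) completionOf_inf hg)
  have pos : ∀ a b : G, 0 ≤ a → 0 ≤ b →
      m (completionOf G a) (completionOf G b) = completionOf G (a * b) := by
    intro a b ha hb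
    -- Polarizing `(a + b)²` yields `a b + b a`; commutativity of `G` makes this `2 a b`.
    have h := sq (a + b) (add_nonneg ha hb)
    rw [add_mul, mul_add, mul_add, IsFRing.mul_comm_of_archimedean b a] at h
    simp only [map_add, LinearMap.add_apply] at h
    rw [sq a ha, sq b hb, symm (completionOf G b)] at h
    have h2 : (2 : ℝ) • m (completionOf G a) (completionOf G b)
        = (2 : ℝ) • completionOf G (a * b) := by
      rw [two_smul, two_smul]
      have h3 := congrArg (fun z => z - completionOf G (a * a) - completionOf G (b * b)) h
      beta_reduce at h3
      convert h3 using 1 <;> abel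
    exact smul_right_injective _ (two_ne_zero (α := ℝ)) h2
  intro a b
  have ha := posPart_nonneg a
  have ha' := negPart_nonneg a
  have hb := posPart_nonneg b
  have hb' := negPart_nonneg b
  rw [← posPart_sub_negPart a, ← posPart_sub_negPart b]
  simp only [map_sub, LinearMap.sub_apply, sub_mul, mul_sub, pos _ _ ha hb, pos _ _ ha hb',
    pos _ _ ha' hb, pos _ _ ha' hb']

namespace VectorLatticeCover

/-- Multiplication operators commute, for a commutative multiplication of `R[G]` extending
that of `G`. -/
theorem mul_left_comm_of_disjoint
    {m : VectorLatticeCover G →ₗ[ℝ] VectorLatticeCover G →ₗ[ℝ] VectorLatticeCover G}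
    (symm : ∀ x y, m x y = m y x)
    (map_sup : ∀ c, 0 ≤ c → ∀ x y, m c (x ⊔ y) = m c x ⊔ m c y)
    (hm : ∀ a b : G, m (of a) (of b) = of (a * b)) (x y z : VectorLatticeCover G) :
    m x (m y z) = m y (m x z) := by
  have step : ∀ x y, 0 ≤ x → 0 ≤ y →
      (∀ a : G, 0 ≤ a → m x (m y (of a)) = m y (m x (of a))) → ∀ z, m x (m y z) = m y (m x z) := by
    intro x y hx hy h z
    have := linearMap_ext (S := m x ∘ₗ m y) (T := m y ∘ₗ m x)
      (fun u v => by simp only [LinearMap.comp_apply, map_sup x hx, map_sup y hy])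
      (fun u v => by simp only [LinearMap.comp_apply, map_sup x hx, map_sup y hy]) h
    exact LinearMap.congr_fun this z
  -- Associativity of `G` enters here. Commutation of operators then follows for one factor in `G`
  -- (`h2`), for two positive factors (`h3`), and in general by positive and negative parts.
  have h1 : ∀ a b : G, 0 ≤ a → 0 ≤ b → ∀ z, m (of a) (m (of b) z) = m (of (a * b)) z := by
    intro a b ha hb z
    have := linearMap_ext (S := m (of a) ∘ₗ m (of b)) (T := m (of (a * b)))
      (fun u v => by
        simp only [LinearMap.comp_apply, map_sup _ (of_nonneg ha), map_sup _ (of_nonneg hb)])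
      (map_sup _ (of_nonneg (IsFRing.mul_nonneg _ _ ha hb)))
      (fun g _ => by rw [LinearMap.comp_apply, hm, hm, hm, mul_assoc])
    exact LinearMap.congr_fun this z
  have h2 : ∀ a : G, 0 ≤ a → ∀ y, 0 ≤ y → ∀ z, m (of a) (m y z) = m y (m (of a) z) :=
    fun a ha y hy => step _ _ (of_nonneg ha) hy fun c hc => by
      rw [symm y (of c), h1 a c ha hc, symm, hm]
  have h3 : ∀ x y, 0 ≤ x → 0 ≤ y → ∀ z, m x (m y z) = m y (m x z) :=
    fun x y hx hy => step _ _ hx hy fun c hc => by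
      rw [symm y (of c), symm x (of c), ← h2 c hc x hx, ← h2 c hc y hy, symm x y]
  have h4 : ∀ x y, 0 ≤ x → m x ∘ₗ m y = m y ∘ₗ m x := by
    intro x y hx
    rw [← posPart_sub_negPart y]
    ext1 z
    simp only [LinearMap.comp_apply, map_sub, LinearMap.sub_apply,
      h3 x _ hx (posPart_nonneg y), h3 x _ hx (negPart_nonneg y)]
  rw [← posPart_sub_negPart x]
  have h5 := LinearMap.congr_fun (h4 _ y (posPart_nonneg x)) z
  have h6 := LinearMap.congr_fun (h4 _ y (negPart_nonneg x)) z
  simp only [LinearMap.comp_apply] at h5 h6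
  simp only [map_sub, LinearMap.sub_apply, h5, h6]

end VectorLatticeCover

end CoverMul

/-! ### The f-algebra structure of the cover and its unit -/

theorem mainTheorem6 {G : Type*} [Ring G] [Lattice G] [IsOrderedAddMonoid G] [IsFRing G]
    [IsArchimedeanLGroup G] :
    (∃ m : VectorLatticeCover G →ₗ[ℝ] VectorLatticeCover G →ₗ[ℝ] VectorLatticeCover G,
      IsFAlgebraMul m ∧
      ∀ a b : G, m (VectorLatticeCover.of a) (VectorLatticeCover.of b)
        = VectorLatticeCover.of (a * b)) ∧
    ∀ m : VectorLatticeCover G →ₗ[ℝ] VectorLatticeCover G →ₗ[ℝ] VectorLatticeCover G,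
      IsFAlgebraMul m →
      (∀ a b : G, m (VectorLatticeCover.of a) (VectorLatticeCover.of b)
        = VectorLatticeCover.of (a * b)) →
      ∀ x : VectorLatticeCover G,
        m (VectorLatticeCover.of 1) x = x ∧ m x (VectorLatticeCover.of 1) = x := by
  constructor
  · obtain ⟨M, symm, nonneg, disj, hM⟩ := exists_mul_completion (G := G)
    let m : VectorLatticeCover G →ₗ[ℝ] VectorLatticeCover G →ₗ[ℝ] VectorLatticeCover G :=
      LinearMap.mk₂ ℝ
        (fun x y => ⟨M x y, mul_mem_coverSubspace symm disj hM x.2 y.2⟩)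
        (fun x x' y => Subtype.ext (by simp)) (fun r x y => Subtype.ext (by simp))
        (fun x y y' => Subtype.ext (by simp)) (fun r x y => Subtype.ext (by simp))
    have m_symm : ∀ x y, m x y = m y x := fun x y => Subtype.ext (symm x y)
    have m_disj : ∀ a b c, a ⊓ b = 0 → 0 ≤ c → m c a ⊓ b = 0 := fun a b c hab hc =>
      Subtype.ext (disj a b c (congrArg Subtype.val hab) hc)
    have m_of : ∀ a b : G, m (VectorLatticeCover.of a) (VectorLatticeCover.of b)
        = VectorLatticeCover.of (a * b) := fun a b => Subtype.ext (hM a b)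
    have m_sup : ∀ c, 0 ≤ c → ∀ x y, m c (x ⊔ y) = m c x ⊔ m c y := fun c hc x y =>
      map_sup_of_inf_eq_zero (m c).toAddMonoidHom (fun a b hab => m_disj a b c hab hc) x y
    refine ⟨m, ⟨fun a b c => ?_, fun a b ha hb => nonneg a b ha hb, m_disj,
      fun a b c hab hc => ?_⟩, m_of⟩
    -- By commutativity and commutation of operators, `(a b) c = c (a b) = a (c b) = a (b c)`.
    · rw [m_symm (m a b) c, VectorLatticeCover.mul_left_comm_of_disjoint m_symm m_sup m_of,
        m_symm c b]
    · rw [m_symm]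
      exact m_disj a b c hab hc
  · intro m hm hof x
    have h1 : (0 : VectorLatticeCover G) ≤ VectorLatticeCover.of 1 :=
      VectorLatticeCover.of_nonneg IsFRing.one_nonneg
    -- An arbitrary `m` is not assumed symmetric, so left and right multiplication by the unit are
    -- compared with the identity separately.
    constructor
    · have := VectorLatticeCover.linearMap_ext (S := m (VectorLatticeCover.of 1))
        (T := LinearMap.id) (hm.map_sup_right h1) (fun _ _ => rfl)
        fun g _ => by rw [hof, one_mul, LinearMap.id_apply]
      exact LinearMap.congr_fun this x
    · have := VectorLatticeCover.linearMap_ext (S := m.flip (VectorLatticeCover.of 1))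
        (T := LinearMap.id) (hm.map_sup_left h1) (fun _ _ => rfl)
        fun g _ => by rw [LinearMap.flip_apply, hof, mul_one, LinearMap.id_apply]
      exact LinearMap.congr_fun this x
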